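/- Let $\xi=(\xi_1,\dots,\xi_p)$ and $\eta=(\eta_1,\dots,\eta_q)$ be real random vectors on a probability space $(\Omega,\mathcal F,\mathrm P)$ such that $(\xi,\eta)$ is a Gaussian random vector, the covariance matrices $R_\xi$ and $R_\eta$ are nonsingular, the joint law $\mathrm P_{\xi\eta}$ is absolutely continuous with respect to $\mathrm P_\xi\otimes \mathrm P_\eta$, and the cross-covariance matrix $R_{\xi\eta}$ has rank $r\ge 1$. Let $\varrho_1\ge\varrho_2\ge\dots\ge\varrho_r>0$ be the positive canonical correlations of $\xi$ and $\eta$, i.e. the positive singular values, counted with multiplicity, of $R_\xi^{-1/2}R_{\xi\eta}R_\eta^{-1/2}$. Let $$i(\xi;\eta)=\log\Big(\frac{\mathrm d \mathrm P_{\xi\eta}}{\mathrm d(\mathrm P_\xi\otimes \mathrm P_\eta)}(\xi,\eta)\Big)$$ be the information density and $I(\xi;\eta)=\mathrm E[i(\xi;\eta)]$ the mutual information. Then $i(\xi;\eta)$ is integrable and its cumulative distribution function $F_{i(\xi;\eta)}(x)=\mathrm P(i(\xi;\eta)\le x)$ is given by $$F_{i(\xi;\eta)}(x)=\begin{cases}\frac12-V\big(I(\xi;\eta)-x\big)&\text{if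 } x\le I(\xi;\eta),\\[1ex] \frac12+V\big(x-I(\xi;\eta)\big)&\text{if } x> I(\xi;\eta),\end{cases}$$ where for $z\ge 0$ $$V(z)=\sum_{k_1=0}^\infty\sum_{k_2=0}^\infty\cdots\sum_{k_{r-1}=0}^\infty\left[\prod_{i=1}^{r-1}\frac{\varrho_r}{\varrho_i}\,\frac{(2k_i)!}{(k_i!)^2\,4^{k_i}}\Big(1-\frac{\varrho_r^2}{\varrho_i^2}\Big)^{k_i}\right]\frac{z}{2\varrho_r}\Big[\mathrm K_{\alpha}\big(\tfrac z{\varrho_r}\big)\mathrm L_{\alpha-1}\big(\tfrac z{\varrho_r}\big)+\mathrm K_{\alpha-1}\big(\tfrac z{\varrho_r}\big)\mathrm L_{\alpha}\big(\tfrac z{\varrho_r}\big)\Big],\qquad \alpha=\frac{r-1}2+k_1+\dots+k_{r-1},$$ and the multiple series converges (absolutely) for every $z\ge 0$. Here $0^0=1$; for $r=1$ the series is the single summand with $\alpha=0$ and empty product $1$; for $z=0$ the summands are read as their limits for $z\downarrow 0$, which are $0$, so that $V(0)=0$; $\mathrm K_\alpha$ is the modified Bessel function of the second kind and order $\alpha$,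 $\mathrm K_\alpha(x)=\int_0^\infty e^{-x\cosh t}\cosh(\alpha t)\,\mathrm dt$ for $x>0$; and $\mathrm L_\alpha$ is the modified Struve function of order $\alpha$, $\mathrm L_\alpha(x)=\sum_{n=0}^\infty \frac{(x/2)^{2n+\alpha+1}}{\Gamma(n+\frac32)\,\Gamma(n+\alpha+\frac32)}$. -/

import Mathlib

open MeasureTheory ProbabilityTheory
open scoped MatrixOrder

noncomputable section

/-- The modified Bessel function of the second kind `K_α(x)`, real order `α` and argument `x > 0`:
`K_α(x) = ∫₀^∞ exp (-x cosh t) cosh (α t) dt`. The integral diverges for `x = 0`, where `K_α` has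
a pole; this definition then returns `0`. -/
def besselK (α x : ℝ) : ℝ :=
  ∫ t in Set.Ioi (0 : ℝ), Real.exp (-x * Real.cosh t) * Real.cosh (α * t)

/-- The modified Struve function `L_α(x)`, real order `α` and argument `x ≥ 0`:
`L_α(x) = (x/2)^(α+1) ∑ₙ (x/2)^(2n) / (Γ(n + 3/2) Γ(n + α + 3/2))`.
At a pole of `Γ` the reciprocal `1/Γ` is `0`, which is also what Lean's conventions give. -/
def struveL (α x : ℝ) : ℝ :=
  (x / 2) ^ (α + 1) *
    ∑' n : ℕ, (x / 2) ^ (2 * n) / (Real.Gamma (n + 3 / 2) * Real.Gamma (n + α + 3 / 2))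

/-- The matrix of covariances `(cov(X_i, Y_j))_{i,j}` of two random vectors. -/
def crossCov {Ω : Type*} [MeasurableSpace Ω] {p q : ℕ}
    (X : Ω → Fin p → ℝ) (Y : Ω → Fin q → ℝ) (P : Measure Ω) : Matrix (Fin p) (Fin q) ℝ :=
  Matrix.of fun i j => cov[fun ω => X ω i, fun ω => Y ω j; P]

/-- The canonical correlations of `X` and `Y`: the singular values of
`R_X^(-1/2) R_XY R_Y^(-1/2)` in descending order, indexed from `0`. The positive ones are those
with index smaller than the rank of `R_XY`. -/
def canonicalCorr {Ω : Type*} [MeasurableSpace Ω] {p q : ℕ}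
    (X : Ω → Fin p → ℝ) (Y : Ω → Fin q → ℝ) (P : Measure Ω) (i : ℕ) : ℝ :=
  (Matrix.toEuclideanLin
    ((CFC.sqrt (crossCov X X P))⁻¹ * crossCov X Y P * (CFC.sqrt (crossCov Y Y P))⁻¹)
      ).singularValues i

/-- The information density `log (dP_XY / d(P_X ⊗ P_Y)) (X, Y)`, a real random variable. -/
def infoDensity {Ω : Type*} [MeasurableSpace Ω] {p q : ℕ}
    (X : Ω → Fin p → ℝ) (Y : Ω → Fin q → ℝ) (P : Measure Ω) (ω : Ω) : ℝ :=
  Real.log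
    ((P.map fun ω => (X ω, Y ω)).rnDeriv ((P.map X).prod (P.map Y)) (X ω, Y ω)).toReal

/-- The mutual information: the expectation of the information density. -/
def mutualInfo {Ω : Type*} [MeasurableSpace Ω] {p q : ℕ}
    (X : Ω → Fin p → ℝ) (Y : Ω → Fin q → ℝ) (P : Measure Ω) : ℝ :=
  ∫ ω, infoDensity X Y P ω ∂P

/-- The summand with multi-index `k = (k_1, …, k_{r-1})` of the series `V(z)`. The sequence `ρ` is
indexed from `0`, so `ρ i` is the `(i+1)`-st canonical correlation and `ρ (r - 1)` the `r`-th. -/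
def vTerm (r : ℕ) (ρ : ℕ → ℝ) (z : ℝ) (k : Fin (r - 1) → ℕ) : ℝ :=
  let c := ρ (r - 1)
  let α : ℝ := ((r : ℝ) - 1) / 2 + ∑ i, (k i : ℝ)
  (∏ i : Fin (r - 1),
      c / ρ i * (((2 * k i).factorial : ℝ) / (((k i).factorial : ℝ) ^ 2 * 4 ^ k i)) *
        (1 - c ^ 2 / ρ i ^ 2) ^ k i) *
    (z / (2 * c)) *
    (besselK α (z / c) * struveL (α - 1) (z / c) + besselK (α - 1) (z / c) * struveL α (z / c))

/-- The `(r-1)`-fold series `V(z)`. -/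
def vFun (r : ℕ) (ρ : ℕ → ℝ) (z : ℝ) : ℝ :=
  ∑' k : Fin (r - 1) → ℕ, vTerm r ρ z k

end

/-! Let `M` be the matrix `coherence X Y P`, that is R_ξ^(-1/2) R_ξη R_η^(-1/2), and let l_j be the
eigenvalues of its Hermitian dilation with blocks 0, M, Mᵀ, 0. One affine bijection, which
normalises both marginals and then rotates to the eigenbasis of the dilation, carries P_ξ ⊗ P_η to
the standard Gaussian law and P_ξη to the product of the laws N(0, 1 + l_j)
(`exists_measurableEmbedding_map_eq_pi`). Absolute continuity forces 1 + l_j > 0, so the information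
density is a sum of independent one-dimensional log-likelihood ratios, each a constant plus a
multiple of a squared Gaussian. The dilation has trace 0, and the centred sum has characteristic
function ∏ (1 - i t l_j)^(-1/2). The nonzero l_j are the numbers ±ϱ_i, so this product equals ∏ (1 +
ϱ_i² t²)^(-1/2) (`integrable_infoDensity_and_charFun`).

To invert it, put w = 1 + ϱ_r² t² and u_i = 1 - ϱ_r²/ϱ_i². Then 1 + ϱ_i² t² = (ϱ_i/ϱ_r)² w (1 -
u_i/w), and the binomial series for (1 - u_i/w)^(-1/2) turns the product into a convex combination
of powers w^(-(α+1/2)) (`hasSum_vgWeight_mul`). Each power is the characteristic function of ϱ_r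
√(2G) N with G gamma of shape α + 1/2 and N an independent standard normal variable
(`charFun_vgLaw`). By uniqueness the centred information density has this mixture as its law.

Mixing Gaussian densities over G gives a density proportional to |x|^α K_α(|x|)
(`vgLaw_eq_withDensity`). The recurrences of K and L show that the bracket in V is its primitive
(`hasDerivAt_vgPrimitive`). Hence V(z) is the mass of (0, z], and symmetry and the absence of atoms
give the distribution function (`cdf_eq_of_charFun`). -/

/-! ### The integral `∫₀^∞ g^(a-1) exp (-g - s / g) dg` -/

/-- The integral `∫₀^∞ g^(a-1) exp (-g - s / g) dg`. -/
noncomputable def gigIntegral (a s : ℝ) : ℝ :=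
  ∫ g in Set.Ioi (0 : ℝ), g ^ (a - 1) * Real.exp (-g - s / g)

/-- One term of the exponential series at s/g suffices. The free power of g on the right absorbs the
singularity of g^(a-1) at 0. -/
theorem exp_neg_div_le (m : ℕ) {s g : ℝ} (hs : 0 < s) (hg : 0 < g) :
    Real.exp (-(s / g)) ≤ m.factorial / s ^ m * g ^ m := by
  have h := Real.pow_div_factorial_le_exp (s / g) (by positivity) m
  rw [Real.exp_neg, inv_le_comm₀ (Real.exp_pos _) (by positivity)]
  refine le_trans (le_of_eq ?_) h
  rw [div_pow]
  field_simp

theorem measurable_gigIntegrand (a s : ℝ) :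
    Measurable fun g : ℝ => g ^ (a - 1) * Real.exp (-g - s / g) := by fun_prop

theorem gigIntegrand_le (a : ℝ) (m : ℕ) {s g : ℝ} (hs : 0 < s) (hg : 0 < g) :
    g ^ (a - 1) * Real.exp (-g - s / g)
      ≤ m.factorial / s ^ m * (Real.exp (-g) * g ^ (a + m - 1)) := by
  have h := exp_neg_div_le m hs hg
  have e1 : g ^ (a + m - 1) = g ^ (a - 1) * g ^ m := by
    rw [← Real.rpow_natCast g m, ← Real.rpow_add hg]; ring_nf
  have h1 : g ^ (a - 1) * Real.exp (-g - s / g)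
      = (g ^ (a - 1) * Real.exp (-g)) * Real.exp (-(s / g)) := by
    rw [sub_eq_add_neg (-g), Real.exp_add]; ring
  rw [h1, e1]
  refine (mul_le_mul_of_nonneg_left h (by positivity)).trans (le_of_eq ?_)
  ring

theorem integrableOn_gigIntegrand (a : ℝ) {s : ℝ} (hs : 0 < s) :
    IntegrableOn (fun g : ℝ => g ^ (a - 1) * Real.exp (-g - s / g)) (Set.Ioi 0) := by
  -- With a + m > 0 the majorant is a convergent Gamma integrand, so every real a is allowed.
  obtain ⟨m, hm⟩ := exists_nat_gt (-a)
  have hG := (Real.GammaIntegral_convergent (s := a + m) (by linarith)).const_mul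
    ((m.factorial : ℝ) / s ^ m)
  refine hG.mono' (measurable_gigIntegrand a s).aestronglyMeasurable ?_
  filter_upwards [ae_restrict_mem measurableSet_Ioi] with g hg
  have hg : 0 < g := hg
  rw [Real.norm_of_nonneg (by positivity)]
  exact gigIntegrand_le a m hs hg

theorem hasDerivAt_gigIntegral (a : ℝ) {s : ℝ} (hs : 0 < s) :
    HasDerivAt (gigIntegral a) (-gigIntegral (a - 1) s) s := by
  have key := hasDerivAt_integral_of_dominated_loc_of_deriv_le
    (μ := volume.restrict (Set.Ioi (0 : ℝ)))
    (F := fun (s : ℝ) (g : ℝ) => g ^ (a - 1) * Real.exp (-g - s / g))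
    (F' := fun (s : ℝ) (g : ℝ) => -(g ^ (a - 1 - 1) * Real.exp (-g - s / g)))
    (x₀ := s) (s := Set.Ioi (s / 2))
    -- The derivative in s decreases in absolute value as s grows, so its value at s/2 dominates on
    -- the half-line above s/2.
    (bound := fun g => g ^ (a - 1 - 1) * Real.exp (-g - (s / 2) / g))
    (Ioi_mem_nhds (by linarith))
    (Filter.Eventually.of_forall fun s => (measurable_gigIntegrand a s).aestronglyMeasurable)
    (integrableOn_gigIntegrand a hs)
    (measurable_gigIntegrand (a - 1) s).neg.aestronglyMeasurable
    ?_ (integrableOn_gigIntegrand (a - 1) (by linarith)) ?_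
  · have h := key.2
    rw [integral_neg] at h
    exact h
  · filter_upwards [ae_restrict_mem measurableSet_Ioi] with g hg x hx
    have hg : 0 < g := hg
    have hx : s / 2 < x := hx
    rw [norm_neg, Real.norm_of_nonneg (by positivity)]
    gcongr
  · filter_upwards [ae_restrict_mem measurableSet_Ioi] with g hg x hx
    have hg : 0 < g := hg
    have h1 : HasDerivAt (fun x : ℝ => -g - x / g) (-(1 / g)) x := by
      simpa using ((hasDerivAt_id x).div_const g).const_sub (-g)
    have h2 := h1.exp.const_mul (g ^ (a - 1))
    convert! h2 using 1
    rw [Real.rpow_sub_one hg.ne' (a - 1)]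
    field_simp

/-! ### The modified Bessel function of the second kind -/

theorem besselK_neg (a x : ℝ) : besselK (-a) x = besselK a x := by
  simp [besselK]

theorem image_mul_exp_univ {y : ℝ} (hy : 0 < y) :
    (fun t : ℝ => y * Real.exp t) '' Set.univ = Set.Ioi 0 := by
  ext g
  simp only [Set.image_univ, Set.mem_range, Set.mem_Ioi]
  constructor
  · rintro ⟨t, rfl⟩; positivity
  · intro hg
    exact ⟨Real.log (g / y), by rw [Real.exp_log (by positivity)]; field_simp⟩

/-- The substitution g = (x/2) e^t turns g + (x²/4)/g into x cosh t, which links `gigIntegral` to K.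
-/
theorem gigIntegrand_comp_exp (a t : ℝ) {x : ℝ} (hx : 0 < x) :
    |x / 2 * Real.exp t| • ((x / 2 * Real.exp t) ^ (a - 1) *
      Real.exp (-(x / 2 * Real.exp t) - x ^ 2 / 4 / (x / 2 * Real.exp t)))
      = (x / 2) ^ a * (Real.exp (-x * Real.cosh t) * Real.exp (a * t)) := by
  have h0 : 0 < x / 2 * Real.exp t := by positivity
  rw [abs_of_pos h0, smul_eq_mul, ← mul_assoc, Real.rpow_sub_one h0.ne',
    mul_div_cancel₀ _ h0.ne', Real.mul_rpow (by positivity) (Real.exp_pos t).le,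
    ← Real.exp_mul, mul_comm t a, mul_assoc, mul_comm (Real.exp (a * t))]
  congr 3
  rw [Real.cosh_eq, Real.exp_neg]
  field_simp
  ring

theorem integrable_exp_mul_cosh_mul_exp (a : ℝ) {x : ℝ} (hx : 0 < x) :
    Integrable fun t : ℝ => Real.exp (-x * Real.cosh t) * Real.exp (a * t) := by
  have h := integrableOn_image_iff_integrableOn_abs_deriv_smul (s := Set.univ)
    (f := fun t : ℝ => x / 2 * Real.exp t) (f' := fun t => x / 2 * Real.exp t)
    MeasurableSet.univ
    (fun t _ => ((Real.hasDerivAt_exp t).const_mul (x / 2)).hasDerivWithinAt)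
    (fun s _ t _ hst => by
      have : x / 2 ≠ 0 := by positivity
      simpa [this] using hst)
    (fun g : ℝ => g ^ (a - 1) * Real.exp (-g - x ^ 2 / 4 / g))
  rw [image_mul_exp_univ (by positivity)] at h
  have h2 := h.1 (integrableOn_gigIntegrand a (by positivity))
  simp_rw [gigIntegrand_comp_exp a _ hx] at h2
  rw [integrableOn_univ] at h2
  have h3 := h2.const_mul ((x / 2) ^ a)⁻¹
  refine h3.congr (Filter.Eventually.of_forall fun t => ?_)
  have : (x / 2) ^ a ≠ 0 := by positivity
  simp only
  field_simp

theorem gigIntegral_eq_integral_exp (a : ℝ) {x : ℝ} (hx : 0 < x) :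
    gigIntegral a (x ^ 2 / 4)
      = (x / 2) ^ a * ∫ t : ℝ, Real.exp (-x * Real.cosh t) * Real.exp (a * t) := by
  have h := integral_image_eq_integral_abs_deriv_smul (s := Set.univ)
    (f := fun t : ℝ => x / 2 * Real.exp t) (f' := fun t => x / 2 * Real.exp t)
    MeasurableSet.univ
    (fun t _ => ((Real.hasDerivAt_exp t).const_mul (x / 2)).hasDerivWithinAt)
    (fun s _ t _ hst => by
      have : x / 2 ≠ 0 := by positivity
      simpa [this] using hst)
    (fun g : ℝ => g ^ (a - 1) * Real.exp (-g - x ^ 2 / 4 / g))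
  rw [image_mul_exp_univ (by positivity)] at h
  simp_rw [gigIntegrand_comp_exp a _ hx] at h
  rw [gigIntegral, h, setIntegral_univ, integral_const_mul]

theorem integral_exp_mul_cosh_mul_exp (a : ℝ) {x : ℝ} (hx : 0 < x) :
    ∫ t : ℝ, Real.exp (-x * Real.cosh t) * Real.exp (a * t) = 2 * besselK a x := by
  have hi := integrable_exp_mul_cosh_mul_exp a hx
  have hi' := integrable_exp_mul_cosh_mul_exp (-a) hx
  rw [← intervalIntegral.integral_Iic_add_Ioi (b := (0 : ℝ)) hi.integrableOn hi.integrableOn,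
    ← neg_zero, ← integral_comp_neg_Ioi, neg_zero, ← integral_add]
  · rw [besselK, ← integral_const_mul]
    refine integral_congr_ae (Filter.Eventually.of_forall fun t => ?_)
    simp only [Real.cosh_neg]
    rw [Real.cosh_eq (a * t)]
    ring_nf
  · have := hi'.integrableOn (s := Set.Ioi 0)
    refine this.congr_fun (fun t _ => ?_) measurableSet_Ioi
    simp
  · exact hi.integrableOn

theorem gigIntegral_eq_besselK (a : ℝ) {x : ℝ} (hx : 0 < x) :
    gigIntegral a (x ^ 2 / 4) = 2 * (x / 2) ^ a * besselK a x := by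
  rw [gigIntegral_eq_integral_exp a hx, integral_exp_mul_cosh_mul_exp a hx]
  ring

theorem rpow_mul_besselK (a : ℝ) {x : ℝ} (hx : 0 < x) :
    x ^ a * besselK a x = 2 ^ (a - 1) * gigIntegral a (x ^ 2 / 4) := by
  rw [gigIntegral_eq_besselK a hx, Real.div_rpow hx.le (by norm_num),
    Real.rpow_sub_one (by norm_num)]
  have : (2 : ℝ) ^ a ≠ 0 := by positivity
  field_simp

theorem besselK_nonneg (a x : ℝ) : 0 ≤ besselK a x :=
  integral_nonneg fun _ => mul_nonneg (Real.exp_pos _).le (Real.cosh_pos _).le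

/-- In the form 2^(a-1) `gigIntegral a (x²/4)` the only dependence on x is through the second
argument. Differentiation there lowers a by one, and the chain rule gives the classical recurrence.
-/
theorem hasDerivAt_rpow_mul_besselK (a : ℝ) {x : ℝ} (hx : 0 < x) :
    HasDerivAt (fun x => x ^ a * besselK a x) (-(x ^ a * besselK (a - 1) x)) x := by
  have h1 : HasDerivAt (fun x : ℝ => x ^ 2 / 4) (x / 2) x := by
    convert! (hasDerivAt_pow 2 x).div_const 4 using 1
    norm_num; ring
  have h2 := ((hasDerivAt_gigIntegral a (s := x ^ 2 / 4) (by positivity)).comp x h1).const_mul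
    ((2 : ℝ) ^ (a - 1))
  have h3 : HasDerivAt (fun x => x ^ a * besselK a x) _ x :=
    h2.congr_of_eventuallyEq (by
      filter_upwards [Ioi_mem_nhds hx] with y hy
      exact rpow_mul_besselK a hy)
  convert! h3 using 1
  have h4 := rpow_mul_besselK (a - 1) hx
  have h5 : x ^ a = x ^ (a - 1) * x := by
    rw [Real.rpow_sub_one hx.ne']; field_simp
  rw [h5, mul_right_comm, h4, Real.rpow_sub_one (by norm_num) (a - 1)]
  ring

theorem hasDerivAt_rpow_neg_mul_besselK (b : ℝ) {x : ℝ} (hx : 0 < x) :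
    HasDerivAt (fun x => x ^ (-b) * besselK b x) (-(x ^ (-b) * besselK (b + 1) x)) x := by
  have h := hasDerivAt_rpow_mul_besselK (-b) hx
  rw [show -b - 1 = -(b + 1) by ring, besselK_neg] at h
  simpa only [besselK_neg] using h

theorem besselK_le_besselK {a b x : ℝ} (hx : 0 < x) (hab : |a| ≤ |b|) :
    besselK a x ≤ besselK b x := by
  have hint : ∀ a : ℝ, IntegrableOn
      (fun t : ℝ => Real.exp (-x * Real.cosh t) * Real.cosh (a * t)) (Set.Ioi 0) := fun a => by
    have h := ((integrable_exp_mul_cosh_mul_exp a hx).add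
      (integrable_exp_mul_cosh_mul_exp (-a) hx)).div_const 2
    refine (h.congr (Filter.Eventually.of_forall fun t => ?_)).integrableOn
    simp only [Pi.add_apply]
    rw [Real.cosh_eq (a * t)]
    ring_nf
  refine integral_mono (hint a) (hint b) fun t => ?_
  have : Real.cosh (a * t) ≤ Real.cosh (b * t) := by
    rw [Real.cosh_le_cosh, abs_mul, abs_mul]
    gcongr
  simp only
  gcongr

/-- Near `0` the function `K_a` is of order at most `x ^ (-b)`, for every `b ≥ |a|`, `b > 0`. -/
theorem exists_besselK_le {a b : ℝ} (hb : 0 < b) (hab : |a| ≤ b) :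
    ∃ C : ℝ, ∀ x : ℝ, 0 < x → besselK a x ≤ C * x ^ (-b) := by
  refine ⟨2 ^ (b - 1) * Real.Gamma b, fun x hx => ?_⟩
  have h1 : besselK a x ≤ besselK b x := besselK_le_besselK hx (by rwa [abs_of_pos hb])
  have h2 := rpow_mul_besselK b hx
  have h3 : gigIntegral b (x ^ 2 / 4) ≤ Real.Gamma b := by
    rw [Real.Gamma_eq_integral hb]
    refine setIntegral_mono_on (integrableOn_gigIntegrand b (by positivity))
      (Real.GammaIntegral_convergent hb) measurableSet_Ioi fun g hg => ?_
    have hg : 0 < g := hg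
    have := gigIntegrand_le b 0 (s := x ^ 2 / 4) (by positivity) hg
    simpa using this
  have h4 : besselK b x = 2 ^ (b - 1) * gigIntegral b (x ^ 2 / 4) * x ^ (-b) := by
    rw [← h2, Real.rpow_neg hx.le]
    have : x ^ b ≠ 0 := by positivity
    field_simp
  rw [h4] at h1
  exact h1.trans (by gcongr)

/-! ### The modified Struve function -/

/-- The coefficients of the series of the modified Struve function. -/
noncomputable def struveCoeff (b : ℝ) (n : ℕ) : ℝ :=
  (Real.Gamma (n + 3 / 2) * Real.Gamma (n + b + 3 / 2))⁻¹

/-- The entire function `y ↦ ∑ₙ yⁿ / (Γ(n + 3/2) Γ(n + b + 3/2))`. -/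
noncomputable def struveSeries (b y : ℝ) : ℝ := ∑' n : ℕ, struveCoeff b n * y ^ n

theorem struveCoeff_pos {b : ℝ} (hb : -1 ≤ b) (n : ℕ) : 0 < struveCoeff b n := by
  have hn : (0 : ℝ) ≤ n := n.cast_nonneg
  have h1 := Real.Gamma_pos_of_pos (s := n + 3 / 2) (by linarith)
  have h2 := Real.Gamma_pos_of_pos (s := n + b + 3 / 2) (by linarith)
  rw [struveCoeff]; positivity

theorem struveCoeff_succ {b : ℝ} (hb : -1 ≤ b) (n : ℕ) :
    struveCoeff b (n + 1) * ((n + 3 / 2) * (n + b + 3 / 2)) = struveCoeff b n := by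
  have hn : (0 : ℝ) ≤ n := n.cast_nonneg
  have h1 := Real.Gamma_pos_of_pos (s := n + 3 / 2) (by linarith)
  have h2 := Real.Gamma_pos_of_pos (s := n + b + 3 / 2) (by linarith)
  have h3 : (n : ℝ) + 3 / 2 ≠ 0 := by linarith
  have h4 : (n : ℝ) + b + 3 / 2 ≠ 0 := by linarith
  rw [struveCoeff, struveCoeff]
  push_cast
  rw [show (n : ℝ) + 1 + 3 / 2 = n + 3 / 2 + 1 by ring,
    show (n : ℝ) + 1 + b + 3 / 2 = n + b + 3 / 2 + 1 by ring, Real.Gamma_add_one h3,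
    Real.Gamma_add_one h4]
  generalize Real.Gamma (n + 3 / 2) = A at *
  generalize Real.Gamma (n + b + 3 / 2) = B at *
  generalize (n : ℝ) + b + 3 / 2 = u at *
  generalize (n : ℝ) + 3 / 2 = v at *
  field_simp

/-- Successive coefficients have ratio at most 2/(n+1), since (n + 3/2)(n + b + 3/2) ≥ (n + 1)/2 for
b ≥ -1. The series is therefore dominated by an exponential one. -/
theorem struveCoeff_le {b : ℝ} (hb : -1 ≤ b) (n : ℕ) :
    struveCoeff b n ≤ struveCoeff b 0 * (2 ^ n / n.factorial) := by
  induction n with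
  | zero => simp
  | succ n ih =>
    have hn : (0 : ℝ) ≤ n := n.cast_nonneg
    have h := struveCoeff_succ hb n
    have h1 : ((n : ℝ) + 1) / 2 ≤ (n + 3 / 2) * (n + b + 3 / 2) := by nlinarith
    have h2 : struveCoeff b (n + 1) * ((n + 1) / 2) ≤ struveCoeff b n := by
      rw [← h]
      exact mul_le_mul_of_nonneg_left h1 (struveCoeff_pos hb _).le
    have h3 : struveCoeff b (n + 1) ≤ struveCoeff b n * (2 / (n + 1)) := by
      rw [← sub_nonneg] at h2 ⊢
      have : struveCoeff b n * (2 / (n + 1)) - struveCoeff b (n + 1)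
        = (struveCoeff b n - struveCoeff b (n + 1) * ((n + 1) / 2)) * (2 / (n + 1)) := by
        field_simp
      rw [this]; positivity
    refine h3.trans ((mul_le_mul_of_nonneg_right ih (by positivity)).trans (le_of_eq ?_))
    rw [Nat.factorial_succ]
    push_cast
    field_simp
    ring

theorem summable_struve_mul_natCast {b : ℝ} (hb : -1 ≤ b) {R : ℝ} (hR : 1 ≤ R) :
    Summable fun n : ℕ => struveCoeff b n * (n * R ^ (n - 1)) := by
  refine Summable.of_nonneg_of_le
    (fun n => mul_nonneg (struveCoeff_pos hb n).le (by positivity)) (fun n => ?_)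
    ((Real.summable_pow_div_factorial (4 * R)).mul_left (struveCoeff b 0))
  have h1 : (n : ℝ) ≤ 2 ^ n := by exact_mod_cast n.lt_two_pow_self.le
  have h2 : R ^ (n - 1) ≤ R ^ n := pow_le_pow_right₀ hR (Nat.sub_le _ _)
  calc struveCoeff b n * (n * R ^ (n - 1))
      ≤ struveCoeff b 0 * (2 ^ n / n.factorial) * (2 ^ n * R ^ n) := by
        have h0 := (struveCoeff_pos hb 0).le
        refine mul_le_mul (struveCoeff_le hb n) ?_ (by positivity) (by positivity)
        gcongr
    _ = struveCoeff b 0 * ((4 * R) ^ n / n.factorial) := by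
        rw [mul_pow, show (4 : ℝ) = 2 * 2 by norm_num, mul_pow]; ring

theorem summable_struveSeries {b : ℝ} (hb : -1 ≤ b) (y : ℝ) :
    Summable fun n : ℕ => struveCoeff b n * y ^ n := by
  refine Summable.of_norm_bounded
    (((Real.summable_pow_div_factorial (2 * |y|)).mul_left (struveCoeff b 0))) fun n => ?_
  rw [norm_mul, norm_pow, Real.norm_eq_abs y, Real.norm_of_nonneg (struveCoeff_pos hb n).le,
    mul_pow]
  refine (mul_le_mul_of_nonneg_right (struveCoeff_le hb n) (by positivity)).trans (le_of_eq ?_)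
  ring

theorem hasDerivAt_struveSeries {b : ℝ} (hb : -1 ≤ b) (y : ℝ) :
    HasDerivAt (struveSeries b) (∑' n : ℕ, struveCoeff b n * (n * y ^ (n - 1))) y := by
  have hy : y ∈ Metric.ball (0 : ℝ) (|y| + 1) := by simp
  have h0 : (0 : ℝ) ∈ Metric.ball (0 : ℝ) (|y| + 1) := by simp; positivity
  have hb' : ∀ (n : ℕ) (z : ℝ), z ∈ Metric.ball (0 : ℝ) (|y| + 1) →
      ‖struveCoeff b n * (n * z ^ (n - 1))‖ ≤ struveCoeff b n * (n * (|y| + 1) ^ (n - 1)) := by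
    intro n z hz
    have hz : |z| < |y| + 1 := by simpa using hz
    rw [norm_mul, norm_mul, norm_pow, Real.norm_of_nonneg (struveCoeff_pos hb n).le,
      Real.norm_eq_abs z, Real.norm_of_nonneg n.cast_nonneg]
    have := (struveCoeff_pos hb n).le
    gcongr
  exact hasDerivAt_tsum_of_isPreconnected (g := fun (n : ℕ) (z : ℝ) => struveCoeff b n * z ^ n)
    (g' := fun (n : ℕ) (z : ℝ) => struveCoeff b n * (n * z ^ (n - 1)))
    (summable_struve_mul_natCast hb (R := |y| + 1) (by linarith [abs_nonneg y]))
    Metric.isOpen_ball (convex_ball _ _).isPreconnected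
    (fun n z _ => (hasDerivAt_pow n z).const_mul _) hb' h0 (summable_struveSeries hb 0) hy

theorem hasSum_mul_deriv_struveSeries {b : ℝ} (hb : -1 ≤ b) (y : ℝ) :
    HasSum (fun n : ℕ => n * (struveCoeff b n * y ^ n))
      (y * ∑' n : ℕ, struveCoeff b n * (n * y ^ (n - 1))) := by
  have hs : Summable fun n : ℕ => struveCoeff b n * (n * y ^ (n - 1)) := by
    refine Summable.of_norm_bounded
      (summable_struve_mul_natCast hb (R := |y| + 1) (by linarith [abs_nonneg y])) fun n => ?_
    rw [norm_mul, norm_mul, norm_pow, Real.norm_of_nonneg (struveCoeff_pos hb n).le,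
      Real.norm_eq_abs y, Real.norm_of_nonneg n.cast_nonneg]
    have := (struveCoeff_pos hb n).le
    gcongr
    linarith
  refine (hs.hasSum.mul_left y).congr_fun fun n => ?_
  rcases n with _ | n
  · simp
  · simp only [Nat.add_sub_cancel, pow_succ]; ring

theorem struveL_eq (b x : ℝ) :
    struveL b x = (x / 2) ^ (b + 1) * struveSeries b ((x / 2) ^ 2) := by
  rw [struveL, struveSeries]
  congr 2
  ext n
  rw [struveCoeff, ← pow_mul, div_eq_inv_mul]

theorem add_half_mul_struveCoeff {b : ℝ} (hb : 0 ≤ b) (n : ℕ) :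
    (b + 1 / 2 + n) * struveCoeff b n = struveCoeff (b - 1) n := by
  have hn : (0 : ℝ) ≤ n := n.cast_nonneg
  have h1 := Real.Gamma_pos_of_pos (s := n + 3 / 2) (by linarith)
  have h2 := Real.Gamma_pos_of_pos (s := n + b + 1 / 2) (by linarith)
  have h4 : (n : ℝ) + b + 1 / 2 ≠ 0 := by linarith
  rw [struveCoeff, struveCoeff, show (n : ℝ) + b + 3 / 2 = n + b + 1 / 2 + 1 by ring,
    Real.Gamma_add_one h4, show (n : ℝ) + (b - 1) + 3 / 2 = n + b + 1 / 2 by ring]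
  field_simp
  ring

theorem struveSeries_sub_one {b : ℝ} (hb : 0 ≤ b) (y : ℝ) :
    (b + 1 / 2) * struveSeries b y + y * ∑' n : ℕ, struveCoeff b n * (n * y ^ (n - 1))
      = struveSeries (b - 1) y := by
  have h := ((summable_struveSeries (b := b) (by linarith) y).hasSum.mul_left (b + 1 / 2)).add
    (hasSum_mul_deriv_struveSeries (b := b) (by linarith) y)
  rw [struveSeries, ← h.tsum_eq, struveSeries]
  congr 1
  ext n
  rw [← add_half_mul_struveCoeff hb]
  ring

theorem half_add_mul_struveCoeff_succ (b : ℝ) (n : ℕ) :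
    (1 / 2 + (n + 1 : ℕ)) * struveCoeff b (n + 1) = struveCoeff (b + 1) n := by
  have hn : (0 : ℝ) ≤ n := n.cast_nonneg
  have h1 := Real.Gamma_pos_of_pos (s := n + 3 / 2) (by linarith)
  have h4 : (n : ℝ) + 3 / 2 ≠ 0 := by linarith
  rw [struveCoeff, struveCoeff]
  push_cast
  rw [show (n : ℝ) + 1 + 3 / 2 = n + 3 / 2 + 1 by ring,
    Real.Gamma_add_one h4, show (n : ℝ) + (b + 1) + 3 / 2 = n + 1 + b + 3 / 2 by ring, mul_inv,
    mul_inv, mul_inv]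
  field_simp
  ring

theorem half_mul_struveCoeff_zero (b : ℝ) :
    1 / 2 * struveCoeff b 0 = (√Real.pi * Real.Gamma (b + 3 / 2))⁻¹ := by
  rw [struveCoeff]
  simp only [Nat.cast_zero, zero_add]
  rw [show (3 / 2 : ℝ) = 1 / 2 + 1 by norm_num, Real.Gamma_add_one (by norm_num),
    Real.Gamma_one_half_eq, mul_inv, mul_inv, mul_inv]
  ring

/-- The operator 1/2 + y d/dy multiplies the n-th coefficient by n + 1/2, which removes one Gamma
factor and shifts the index. The term n = 0 has no partner and remains as the inhomogeneous constant
of the Struve recurrence. -/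
theorem struveSeries_add_one {b : ℝ} (hb : -1 ≤ b) (y : ℝ) :
    1 / 2 * struveSeries b y + y * ∑' n : ℕ, struveCoeff b n * (n * y ^ (n - 1))
      = (√Real.pi * Real.Gamma (b + 3 / 2))⁻¹ + y * struveSeries (b + 1) y := by
  have h := ((summable_struveSeries hb y).hasSum.mul_left (1 / 2)).add
    (hasSum_mul_deriv_struveSeries hb y)
  rw [struveSeries, ← h.tsum_eq, h.summable.tsum_eq_zero_add, struveSeries, ← tsum_mul_left,
    ← half_mul_struveCoeff_zero]
  congr 1
  · simp
  · congr 1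
    ext n
    rw [← half_add_mul_struveCoeff_succ]
    ring

theorem hasDerivAt_struveSeries_sq {b : ℝ} (hb : -1 ≤ b) (x : ℝ) :
    HasDerivAt (fun x : ℝ => struveSeries b ((x / 2) ^ 2))
      ((∑' n : ℕ, struveCoeff b n * (n * ((x / 2) ^ 2) ^ (n - 1))) * (x / 2)) x := by
  have h1 : HasDerivAt (fun x : ℝ => (x / 2) ^ 2) (x / 2) x := by
    convert! ((hasDerivAt_id x).div_const 2).pow 2 using 1
    simp; ring
  exact (hasDerivAt_struveSeries hb _).comp x h1

theorem hasDerivAt_rpow_mul_struveL {b : ℝ} (hb : 0 ≤ b) {x : ℝ} (hx : 0 < x) :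
    HasDerivAt (fun x => x ^ b * struveL b x) (x ^ b * struveL (b - 1) x) x := by
  have h2 : HasDerivAt (fun x : ℝ => (x / 2) ^ (2 * b + 1)) _ x :=
    ((hasDerivAt_id x).div_const 2).rpow_const (p := 2 * b + 1) (Or.inl (by simp; positivity))
  have h3 := (h2.mul (hasDerivAt_struveSeries_sq (b := b) (by linarith) x)).const_mul
    ((2 : ℝ) ^ b)
  have e : ∀ y : ℝ, 0 < y → y ^ b = 2 ^ b * (y / 2) ^ b := fun y hy => by
    rw [← Real.mul_rpow (by norm_num) (by positivity)]; congr 1; ring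
  have h4 : HasDerivAt (fun x => x ^ b * struveL b x) _ x :=
    h3.congr_of_eventuallyEq (by
      filter_upwards [Ioi_mem_nhds hx] with y hy
      have hy : 0 < y := hy
      simp only [Pi.mul_apply]
      rw [struveL_eq, e y hy, show 2 * b + 1 = b + (b + 1) by ring,
        Real.rpow_add (x := y / 2) (by positivity) b (b + 1)]
      generalize (y / 2) ^ (b + 1) = A
      generalize struveSeries b _ = S
      ring)
  convert! h4 using 1
  rw [struveL_eq, e x hx, ← struveSeries_sub_one hb, show 2 * b + 1 - 1 = b + b by ring,
    show 2 * b + 1 = b + b + 1 by ring, sub_add_cancel]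
  simp only [id]
  rw [Real.rpow_add_one (by positivity), Real.rpow_add (by positivity)]
  generalize struveSeries b _ = S
  generalize (∑' n : ℕ, struveCoeff b n * (n * ((x / 2) ^ 2) ^ (n - 1))) = T
  ring

theorem hasDerivAt_rpow_neg_mul_struveL {b : ℝ} (hb : -1 ≤ b) {x : ℝ} (hx : 0 < x) :
    HasDerivAt (fun x => x ^ (-b) * struveL b x)
      (x ^ (-b) * struveL (b + 1) x + 2 ^ (-b) / (√Real.pi * Real.Gamma (b + 3 / 2))) x := by
  have h2 : HasDerivAt (fun x : ℝ => x / 2) (1 / 2) x := (hasDerivAt_id x).div_const 2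
  have h3 := (h2.mul (hasDerivAt_struveSeries_sq hb x)).const_mul ((2 : ℝ) ^ (-b))
  have e : ∀ y : ℝ, 0 < y → y ^ (-b) * (y / 2) ^ (b + 1) = 2 ^ (-b) * (y / 2) := fun y hy => by
    have h : y ^ (-b) = 2 ^ (-b) * (y / 2) ^ (-b) := by
      rw [← Real.mul_rpow (by norm_num) (by positivity)]; congr 1; ring
    rw [h, mul_assoc, ← Real.rpow_add (by positivity)]; simp
  have h4 : HasDerivAt (fun x => x ^ (-b) * struveL b x) _ x :=
    h3.congr_of_eventuallyEq (by
      filter_upwards [Ioi_mem_nhds hx] with y hy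
      have hy : 0 < y := hy
      simp only [Pi.mul_apply]
      rw [struveL_eq, ← mul_assoc, e y hy, mul_assoc])
  convert! h4 using 1
  have h5 := struveSeries_add_one hb ((x / 2) ^ 2)
  rw [struveL_eq, ← mul_assoc, Real.rpow_add_one (by positivity) (b + 1), ← mul_assoc, e x hx,
    div_eq_mul_inv ((2 : ℝ) ^ (-b))]
  generalize struveSeries b _ = S at *
  generalize struveSeries (b + 1) _ = S' at *
  generalize (∑' n : ℕ, struveCoeff b n * (n * ((x / 2) ^ 2) ^ (n - 1))) = T at *
  linear_combination (-(2 : ℝ) ^ (-b)) * h5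

/-! ### The variance-gamma density and its primitive -/

/-- The density of the symmetric variance-gamma law of shape `a + 1/2`. -/
noncomputable def vgDensity (a x : ℝ) : ℝ :=
  |x| ^ a * besselK a |x| / (2 ^ a * √Real.pi * Real.Gamma (a + 1 / 2))

/-- The primitive of `vgDensity a` on `[0, ∞)` that vanishes at `0`. -/
noncomputable def vgPrimitive (a x : ℝ) : ℝ :=
  x / 2 * (besselK a x * struveL (a - 1) x + besselK (a - 1) x * struveL a x)

theorem vgDensity_nonneg {a : ℝ} (ha : 0 ≤ a) (x : ℝ) : 0 ≤ vgDensity a x := by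
  have := besselK_nonneg a |x|
  have := Real.Gamma_pos_of_pos (s := a + 1 / 2) (by linarith)
  rw [vgDensity]; positivity

/-- The factor x/2 gives this whatever `besselK` returns at its pole. That it is also the limit from
the right is `tendsto_vgPrimitive`. -/
theorem vgPrimitive_zero (a : ℝ) : vgPrimitive a 0 = 0 := by simp [vgPrimitive]

/-- Group the primitive as half of (x^a K_a)(x^(1-a) L_(a-1)) + (x^(1-a) K_(a-1))(x^a L_a). In the
product rule the terms K_(a-1) L_(a-1) and K_a L_a cancel, and only x^a K_a times the inhomogeneous
Struve constant is left. -/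
theorem hasDerivAt_vgPrimitive {a : ℝ} (ha : 0 ≤ a) {x : ℝ} (hx : 0 < x) :
    HasDerivAt (vgPrimitive a) (vgDensity a x) x := by
  have k1 := hasDerivAt_rpow_mul_besselK a hx
  have k2 := hasDerivAt_rpow_neg_mul_besselK (a - 1) hx
  have l1 := hasDerivAt_rpow_neg_mul_struveL (b := a - 1) (by linarith) hx
  have l2 := hasDerivAt_rpow_mul_struveL ha hx
  have h := ((k1.mul l1).add (k2.mul l2)).div_const 2
  have e : ∀ y : ℝ, 0 < y → y ^ a * y ^ (-(a - 1)) = y := fun y hy => by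
    rw [← Real.rpow_add hy]; simp
  have h4 : HasDerivAt (vgPrimitive a) _ x :=
    h.congr_of_eventuallyEq (by
      filter_upwards [Ioi_mem_nhds hx] with y hy
      simp only [Pi.mul_apply, Pi.add_apply, vgPrimitive]
      linear_combination (-(besselK a y * struveL (a - 1) y +
        besselK (a - 1) y * struveL a y) / 2) * e y hy)
  convert! h4 using 1
  have h2 : (2 : ℝ) ^ (-(a - 1)) = 2 / 2 ^ a := by
    rw [Real.rpow_neg (by norm_num), Real.rpow_sub_one (by norm_num)]
    field_simp
  rw [vgDensity, abs_of_pos hx, h2, sub_add_cancel,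
    show a - 1 + 3 / 2 = a + 1 / 2 by ring]
  have := Real.Gamma_pos_of_pos (s := a + 1 / 2) (by linarith)
  generalize Real.Gamma (a + 1 / 2) = G at *
  field_simp
  ring

theorem tendsto_mul_besselK_mul_struveL {a b c : ℝ} (hb : 0 < b) (hab : |a| ≤ b)
    (hc : -1 ≤ c) (hbc : b < c + 2) :
    Filter.Tendsto (fun x => x * (besselK a x * struveL c x)) (nhdsWithin 0 (Set.Ioi 0))
      (nhds 0) := by
  obtain ⟨C, hC⟩ := exists_besselK_le hb hab
  have h1 : Filter.Tendsto (fun x : ℝ => struveSeries c ((x / 2) ^ 2)) (nhdsWithin 0 (Set.Ioi 0))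
      (nhds (struveSeries c ((0 / 2) ^ 2))) :=
    (hasDerivAt_struveSeries_sq hc 0).continuousAt.tendsto.mono_left nhdsWithin_le_nhds
  have h2 : Filter.Tendsto (fun x : ℝ => x ^ (c + 2 - b)) (nhdsWithin 0 (Set.Ioi 0)) (nhds 0) := by
    have := (Real.continuousAt_rpow_const 0 (c + 2 - b) (Or.inr (by linarith))).tendsto
    rw [Real.zero_rpow (by linarith)] at this
    exact this.mono_left nhdsWithin_le_nhds
  have h3 := (h2.const_mul (C / 2 ^ (c + 1))).mul h1
  rw [mul_zero, zero_mul] at h3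
  have hS : ∀ x : ℝ, 0 ≤ struveSeries c ((x / 2) ^ 2) := fun x =>
    tsum_nonneg fun n => mul_nonneg (struveCoeff_pos hc n).le (by positivity)
  refine squeeze_zero' ?_ ?_ h3
  · filter_upwards [self_mem_nhdsWithin] with x hx
    have hx : 0 < x := hx
    have := besselK_nonneg a x
    have := hS x
    rw [struveL_eq]; positivity
  · filter_upwards [self_mem_nhdsWithin] with x hx
    have hx : 0 < x := hx
    have h4 := hC x hx
    rw [struveL_eq]
    have h5 := hS x
    have e : C / 2 ^ (c + 1) * x ^ (c + 2 - b) * struveSeries c ((x / 2) ^ 2)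
        = x * (C * x ^ (-b) * ((x / 2) ^ (c + 1) * struveSeries c ((x / 2) ^ 2))) := by
      rw [show c + 2 - b = 1 + -b + (c + 1) by ring, Real.rpow_add hx, Real.rpow_add hx,
        Real.rpow_one, Real.div_rpow hx.le (by norm_num)]
      ring
    rw [e]
    gcongr

theorem tendsto_vgPrimitive {a : ℝ} (ha : 0 ≤ a) :
    Filter.Tendsto (vgPrimitive a) (nhdsWithin 0 (Set.Ioi 0)) (nhds 0) := by
  -- The exponent a + 1/2 instead of a covers a = 0, where K_0 has a logarithmic singularity. It
  -- still lies below c + 2 = a + 1.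
  have h1 := tendsto_mul_besselK_mul_struveL (a := a) (b := a + 1 / 2) (c := a - 1)
    (by linarith) (by rw [abs_of_nonneg ha]; linarith) (by linarith) (by linarith)
  have h2 := tendsto_mul_besselK_mul_struveL (a := a - 1) (b := a + 1) (c := a)
    (by linarith) (by rw [abs_le]; constructor <;> linarith) (by linarith) (by linarith)
  have h3 := (h1.add h2).div_const 2
  rw [add_zero, zero_div] at h3
  refine h3.congr fun x => ?_
  rw [vgPrimitive]; ring

theorem continuousOn_vgPrimitive {a : ℝ} (ha : 0 ≤ a) (z : ℝ) :
    ContinuousOn (vgPrimitive a) (Set.Icc 0 z) := by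
  intro x hx
  rcases hx.1.eq_or_lt with rfl | h
  · have : ContinuousWithinAt (vgPrimitive a) (Set.Ici 0) 0 := by
      rw [← continuousWithinAt_Ioi_iff_Ici, ContinuousWithinAt, vgPrimitive_zero]
      exact tendsto_vgPrimitive ha
    exact this.mono Set.Icc_subset_Ici_self
  · exact (hasDerivAt_vgPrimitive ha h).continuousAt.continuousWithinAt

/-- No bound on the density near 0 is needed: a nonnegative derivative of a function continuous up
to the endpoints is integrable. -/
theorem integrableOn_vgDensity {a : ℝ} (ha : 0 ≤ a) {z : ℝ} :
    IntegrableOn (vgDensity a) (Set.Ioc 0 z) :=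
  intervalIntegral.integrableOn_deriv_of_nonneg (continuousOn_vgPrimitive ha z)
    (fun _ hx => hasDerivAt_vgPrimitive ha hx.1) (fun x _ => vgDensity_nonneg ha x)

theorem setIntegral_vgDensity {a : ℝ} (ha : 0 ≤ a) {z : ℝ} (hz : 0 ≤ z) :
    ∫ x in Set.Ioc 0 z, vgDensity a x = vgPrimitive a z := by
  rw [← intervalIntegral.integral_of_le hz,
    intervalIntegral.integral_eq_sub_of_hasDerivAt_of_le hz (continuousOn_vgPrimitive ha z)
      (fun x hx => hasDerivAt_vgPrimitive ha hx.1)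
      ((intervalIntegrable_iff_integrableOn_Ioc_of_le hz).2 (integrableOn_vgDensity ha)),
    vgPrimitive_zero, sub_zero]

/-! ### The variance-gamma law as a Gaussian scale mixture -/

/-- The law of `√(2 G) N`, where `G` is gamma distributed with shape `b` and rate `1`, and `N` is
standard normal and independent of `G`. -/
noncomputable def vgLaw (b : ℝ) : Measure ℝ :=
  ((gammaMeasure b 1).prod (gaussianReal 0 1)).map fun p => √(2 * p.1) * p.2

theorem measurable_sqrt_mul : Measurable fun p : ℝ × ℝ => √(2 * p.1) * p.2 := by fun_prop

theorem isProbabilityMeasure_vgLaw {b : ℝ} (hb : 0 < b) : IsProbabilityMeasure (vgLaw b) := by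
  have := isProbabilityMeasure_gammaMeasure hb one_pos
  exact Measure.isProbabilityMeasure_map measurable_sqrt_mul.aemeasurable

theorem gammaMeasure_eq_withDensity {b : ℝ} :
    gammaMeasure b 1 = (volume.restrict (Set.Ioi 0)).withDensity
      fun g => ENNReal.ofReal (g ^ (b - 1) * Real.exp (-g) / Real.Gamma b) := by
  rw [gammaMeasure, ← withDensity_indicator measurableSet_Ioi]
  refine withDensity_congr_ae ?_
  have h0 : ∀ᵐ g : ℝ, g ≠ 0 := by simp [ae_iff]
  filter_upwards [h0] with g hg
  rcases lt_or_gt_of_ne hg with h | h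
  · rw [gammaPDF_of_neg h, Set.indicator_of_notMem (by simpa using h.le)]
  · rw [gammaPDF_of_nonneg h.le, Set.indicator_of_mem (by simpa using h), Real.one_rpow, one_mul]
    congr 1
    ring

theorem ae_pos_gammaMeasure (b : ℝ) : ∀ᵐ g ∂gammaMeasure b 1, 0 < g := by
  rw [gammaMeasure_eq_withDensity]
  exact (withDensity_absolutelyContinuous _ _).ae_le (ae_restrict_mem measurableSet_Ioi)

theorem integral_exp_neg_mul_gammaMeasure {b s : ℝ} (hb : 0 < b) (hs : 0 ≤ s) :
    ∫ g, Real.exp (-(s * g)) ∂gammaMeasure b 1 = (1 + s) ^ (-b) := by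
  have hG := Real.Gamma_pos_of_pos hb
  rw [gammaMeasure_eq_withDensity, integral_withDensity_eq_integral_toReal_smul (by fun_prop)
    (by simp)]
  have h := Real.integral_rpow_mul_exp_neg_mul_Ioi (a := b) (r := 1 + s) hb (by linarith)
  have h2 : (1 + s) ^ (-b) = (1 / (1 + s)) ^ b * Real.Gamma b / Real.Gamma b := by
    rw [mul_div_cancel_right₀ _ hG.ne', one_div, Real.inv_rpow (by linarith),
      Real.rpow_neg (by linarith)]
  rw [h2, ← h, ← integral_div]
  refine setIntegral_congr_fun measurableSet_Ioi fun g hg => ?_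
  have hg : 0 < g := hg
  simp only [smul_eq_mul]
  rw [ENNReal.toReal_ofReal (by positivity), show -((1 + s) * g) = -g + -(s * g) by ring,
    Real.exp_add]
  ring

/-- Given G = g the variable is N(0, 2g), with characteristic function exp(-g t²). Averaging over g
is the Laplace transform of the gamma law at t². -/
theorem charFun_vgLaw {b : ℝ} (hb : 0 < b) (t : ℝ) :
    charFun (vgLaw b) t = ((1 + t ^ 2) ^ (-b) : ℝ) := by
  have := isProbabilityMeasure_gammaMeasure hb one_pos
  rw [charFun_apply_real, vgLaw, integral_map measurable_sqrt_mul.aemeasurable (by fun_prop),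
    integral_prod]
  · rw [← integral_exp_neg_mul_gammaMeasure hb (sq_nonneg t), ← integral_complex_ofReal]
    refine integral_congr_ae ?_
    filter_upwards [ae_pos_gammaMeasure b] with g hg
    have h := charFun_gaussianReal (μ := 0) (v := 1) (t * √(2 * g))
    rw [charFun_apply_real] at h
    convert! h using 1
    · congr 1
      ext n
      push_cast
      ring_nf
    · have h2 : (√(2 * g)) ^ 2 = 2 * g := Real.sq_sqrt (by positivity)
      have h3 : ((√(2 * g) : ℝ) : ℂ) ^ 2 = 2 * g := by exact_mod_cast h2
      push_cast
      congr 1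
      rw [mul_pow, h3]
      simp
      ring
  · refine (integrable_const (1 : ℝ)).mono' (by fun_prop) (Filter.Eventually.of_forall fun p => ?_)
    rw [← Complex.ofReal_mul, Complex.norm_exp_ofReal_mul_I]

theorem gaussianReal_zero_apply_eq {v : ℝ} (hv : 0 < v) (s : Set ℝ) :
    gaussianReal 0 v.toNNReal s
      = ∫⁻ x in s, ENNReal.ofReal ((√(2 * Real.pi * v))⁻¹ * Real.exp (-x ^ 2 / (2 * v))) := by
  rw [gaussianReal_apply _ (by simpa using hv)]
  simp [gaussianPDF, gaussianPDFReal, hv.le]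

theorem map_sqrt_mul_gaussianReal {g : ℝ} (hg : 0 < g) :
    (gaussianReal 0 1).map (fun n => √(2 * g) * n) = gaussianReal 0 (2 * g).toNNReal := by
  have h := gaussianReal_map_const_mul (μ := 0) (v := 1) (√(2 * g))
  rw [mul_zero, mul_one] at h
  convert! h using 2
  ext
  have := Real.sq_sqrt (show 0 ≤ 2 * g by positivity)
  rw [Real.coe_toNNReal _ (by positivity)]
  exact this.symm

/-- The Gaussian normalisation contributes g^(-1/2), which lowers the gamma exponent a - 1/2 to a -
1 and produces `gigIntegral a` at x²/4. -/
theorem lintegral_gamma_mul_gaussian {a : ℝ} (ha : 0 ≤ a) {x : ℝ} (hx : x ≠ 0) :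
    ∫⁻ g in Set.Ioi 0, ENNReal.ofReal (g ^ (a + 1 / 2 - 1) * Real.exp (-g) /
      Real.Gamma (a + 1 / 2)) * ENNReal.ofReal ((√(2 * Real.pi * (2 * g)))⁻¹ *
        Real.exp (-x ^ 2 / (2 * (2 * g)))) = ENNReal.ofReal (vgDensity a x) := by
  have hG := Real.Gamma_pos_of_pos (s := a + 1 / 2) (by linarith)
  have hx' : 0 < |x| := by positivity
  have hi := integrableOn_gigIntegrand a (s := |x| ^ 2 / 4) (by positivity)
  have h1 : vgDensity a x = ∫ g in Set.Ioi 0, (2 * √Real.pi * Real.Gamma (a + 1 / 2))⁻¹ *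
      (g ^ (a - 1) * Real.exp (-g - |x| ^ 2 / 4 / g)) := by
    have := gigIntegral_eq_besselK a hx'
    rw [gigIntegral] at this
    rw [integral_const_mul, this, vgDensity, Real.div_rpow hx'.le (by norm_num)]
    field_simp
  rw [h1, ofReal_integral_eq_lintegral_ofReal (hi.const_mul _)]
  · refine setLIntegral_congr_fun measurableSet_Ioi fun g hg => ?_
    have hg : 0 < g := hg
    rw [← ENNReal.ofReal_mul (by positivity)]
    congr 1
    have e1 : √(2 * Real.pi * (2 * g)) = 2 * √Real.pi * g ^ (1 / 2 : ℝ) := by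
      rw [← Real.sqrt_eq_rpow, show 2 * Real.pi * (2 * g) = 2 ^ 2 * Real.pi * g by ring,
        Real.sqrt_mul (by positivity), Real.sqrt_mul (by positivity),
        Real.sqrt_sq (by norm_num)]
    have e2 : g ^ (a + 1 / 2 - 1) = g ^ (a - 1) * g ^ (1 / 2 : ℝ) := by
      rw [← Real.rpow_add hg]; ring_nf
    have e3 : Real.exp (-g - |x| ^ 2 / 4 / g)
        = Real.exp (-g) * Real.exp (-x ^ 2 / (2 * (2 * g))) := by
      rw [← Real.exp_add, sq_abs]
      congr 1
      field_simp
      ring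
    rw [e1, e2, e3]
    field_simp
  · filter_upwards [ae_restrict_mem measurableSet_Ioi] with g hg
    have hg : 0 < g := hg
    simp only [Pi.zero_apply]
    positivity

theorem vgLaw_eq_withDensity {a : ℝ} (ha : 0 ≤ a) :
    vgLaw (a + 1 / 2) = volume.withDensity fun x => ENNReal.ofReal (vgDensity a x) := by
  have := isProbabilityMeasure_gammaMeasure (a := a + 1 / 2) (r := 1) (by linarith) one_pos
  ext s hs
  rw [vgLaw, Measure.map_apply measurable_sqrt_mul hs,
    Measure.prod_apply (measurable_sqrt_mul hs), withDensity_apply _ hs]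
  have h1 : ∀ᵐ g ∂gammaMeasure (a + 1 / 2) 1,
      gaussianReal 0 1 (Prod.mk g ⁻¹' ((fun p : ℝ × ℝ => √(2 * p.1) * p.2) ⁻¹' s))
        = ∫⁻ x in s, ENNReal.ofReal ((√(2 * Real.pi * (2 * g)))⁻¹ *
          Real.exp (-x ^ 2 / (2 * (2 * g)))) := by
    filter_upwards [ae_pos_gammaMeasure (a + 1 / 2)] with g hg
    rw [← gaussianReal_zero_apply_eq (by positivity) s, ← map_sqrt_mul_gaussianReal hg,
      Measure.map_apply (by fun_prop) hs]
    rfl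
  rw [lintegral_congr_ae h1, gammaMeasure_eq_withDensity,
    lintegral_withDensity_eq_lintegral_mul₀ (by fun_prop)
      (Measurable.lintegral_prod_right (by fun_prop)).aemeasurable]
  simp only [Pi.mul_apply]
  simp_rw [← lintegral_const_mul' _ _ ENNReal.ofReal_ne_top]
  rw [lintegral_lintegral_swap (by fun_prop)]
  refine lintegral_congr_ae (ae_restrict_of_ae ?_)
  have h0 : ∀ᵐ x : ℝ, x ≠ 0 := by simp [ae_iff]
  filter_upwards [h0] with x hx
  exact lintegral_gamma_mul_gaussian ha hx

theorem vgLaw_Ioc {a : ℝ} (ha : 0 ≤ a) {z : ℝ} (hz : 0 ≤ z) :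
    (vgLaw (a + 1 / 2)).real (Set.Ioc 0 z) = vgPrimitive a z := by
  rw [vgLaw_eq_withDensity ha, measureReal_def, withDensity_apply _ measurableSet_Ioc,
    ← ofReal_integral_eq_lintegral_ofReal (integrableOn_vgDensity ha)
      (Filter.Eventually.of_forall fun x => vgDensity_nonneg ha x),
    ENNReal.toReal_ofReal (setIntegral_nonneg measurableSet_Ioc fun x _ => vgDensity_nonneg ha x),
    setIntegral_vgDensity ha hz]

theorem vgLaw_singleton {a : ℝ} (ha : 0 ≤ a) (x : ℝ) : vgLaw (a + 1 / 2) {x} = 0 := by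
  rw [vgLaw_eq_withDensity ha]
  exact withDensity_absolutelyContinuous _ _ (measure_singleton x)

/-! ### Mixtures of variance-gamma laws -/

/-- The rising factorial of 1/2 of length n is (2n)!/(n! 4^n). This identifies the weights in V with
the binomial coefficients of (1 - u)^(-1/2). -/
theorem ringChoose_half_add (n : ℕ) :
    Ring.choose ((1 / 2 : ℝ) + n - 1) n
      = ((2 * n).factorial : ℝ) / ((n.factorial : ℝ) ^ 2 * 4 ^ n) := by
  have h := Ring.factorial_nsmul_multichoose_eq_ascPochhammer (1 / 2 : ℝ) n
  have h2 : ∀ n : ℕ, (ascPochhammer ℕ n).smeval (1 / 2 : ℝ)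
      = ((2 * n).factorial : ℝ) / ((n.factorial : ℝ) * 4 ^ n) := by
    intro n
    induction n with
    | zero => simp [Polynomial.smeval_one]
    | succ n ih =>
      rw [ascPochhammer_succ_right, Polynomial.smeval_mul, ih, Polynomial.smeval_add,
        Polynomial.smeval_X, Polynomial.smeval_natCast, Nat.factorial_succ n,
        show 2 * (n + 1) = 2 * n + 1 + 1 by ring, Nat.factorial_succ, Nat.factorial_succ]
      push_cast
      simp only [pow_one, pow_zero, nsmul_eq_mul, mul_one]
      field_simp
      ring
  rw [h2, Ring.multichoose_eq] at h
  rw [nsmul_eq_mul] at h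
  have : (n.factorial : ℝ) ≠ 0 := by positivity
  field_simp at h ⊢
  linear_combination h

theorem hasSum_central_mul_pow {u : ℝ} (h0 : 0 ≤ u) (h1 : u < 1) :
    HasSum (fun k : ℕ => ((2 * k).factorial : ℝ) / ((k.factorial : ℝ) ^ 2 * 4 ^ k) * u ^ k)
      ((1 - u) ^ (-(1 / 2) : ℝ)) := by
  have h := (Real.one_div_one_sub_rpow_hasFPowerSeriesOnBall_zero (1 / 2)).hasSum (y := u)
    (by simpa [enorm_eq_nnnorm, ← NNReal.coe_lt_coe, abs_of_nonneg h0] using h1)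
  rw [zero_add] at h
  rw [Real.rpow_neg (by linarith), ← one_div ((1 - u) ^ (1 / 2 : ℝ))]
  refine h.congr_fun fun k => ?_
  rw [FormalMultilinearSeries.ofScalars_apply_eq, ringChoose_half_add, smul_eq_mul]

theorem hasSum_pi_prod {n : ℕ} {f : Fin n → ℕ → ℝ} (hf : ∀ i k, 0 ≤ f i k) {a : Fin n → ℝ}
    (h : ∀ i, HasSum (f i) (a i)) :
    HasSum (fun k : Fin n → ℕ => ∏ i, f i (k i)) (∏ i, a i) := by
  induction n with
  | zero => simp [hasSum_unique]
  | succ n ih =>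
    have ih' := ih (f := fun i => f i.succ) (fun i k => hf _ _) (fun i => h i.succ)
    have hs := (h 0).summable.mul_of_nonneg ih'.summable (fun k => hf 0 k)
      (fun k => Finset.prod_nonneg fun i _ => hf _ _)
    have := (h 0).mul ih' hs
    rw [← (Fin.consEquiv fun _ => ℕ).hasSum_iff, Fin.prod_univ_succ]
    refine this.congr_fun fun k => ?_
    simp [Fin.prod_univ_succ, Fin.consEquiv]

/-- The weight of the multi-index `k` in the variance-gamma mixture. -/
noncomputable def vgWeight (m : ℕ) (ρ : ℕ → ℝ) (k : Fin m → ℕ) : ℝ :=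
  ∏ i : Fin m, ρ m / ρ i * (((2 * k i).factorial : ℝ) / (((k i).factorial : ℝ) ^ 2 * 4 ^ k i)) *
    (1 - ρ m ^ 2 / ρ i ^ 2) ^ k i

/-- The Bessel order attached to the multi-index `k`. -/
noncomputable def vgOrder (m : ℕ) (k : Fin m → ℕ) : ℝ := (m : ℝ) / 2 + ∑ i, (k i : ℝ)

theorem vgOrder_nonneg (m : ℕ) (k : Fin m → ℕ) : 0 ≤ vgOrder m k := by
  rw [vgOrder]; positivity

theorem vTerm_succ (m : ℕ) (ρ : ℕ → ℝ) (z : ℝ) (k : Fin m → ℕ) :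
    vTerm (m + 1) ρ z k = vgWeight m ρ k * vgPrimitive (vgOrder m k) (z / ρ m) := by
  change vgWeight m ρ k * (z / (2 * ρ m)) *
    (besselK ((((m + 1 : ℕ) : ℝ) - 1) / 2 + ∑ i, (k i : ℝ)) (z / ρ m) * _ + _) = _
  rw [vgPrimitive, vgOrder, Nat.cast_add, Nat.cast_one, add_sub_cancel_right,
    mul_comm 2 (ρ m), ← div_div, mul_assoc]
  rfl

section mixture

variable {m : ℕ} {ρ : ℕ → ℝ}

theorem one_sub_sq_ratio_mem (hρ : Antitone ρ) (hm : 0 < ρ m) (i : Fin m) :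
    0 ≤ 1 - ρ m ^ 2 / ρ i ^ 2 ∧ 1 - ρ m ^ 2 / ρ i ^ 2 < 1 := by
  have h1 : ρ m ≤ ρ i := hρ i.2.le
  have h2 : 0 < ρ i := hm.trans_le h1
  constructor
  · rw [sub_nonneg, div_le_one (by positivity)]
    gcongr
  · have : 0 < ρ m ^ 2 / ρ i ^ 2 := by positivity
    linarith

theorem vgWeight_nonneg (hρ : Antitone ρ) (hm : 0 < ρ m) (k : Fin m → ℕ) :
    0 ≤ vgWeight m ρ k := by
  refine Finset.prod_nonneg fun i _ => ?_
  have h1 : ρ m ≤ ρ i := hρ i.2.le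
  have h2 : 0 < ρ i := hm.trans_le h1
  have := (one_sub_sq_ratio_mem hρ hm i).1
  positivity

/-- This is the product of the binomial series of the factors with i < m. Each contributes w^(-1/2)
w^(-k_i), and the factor i = m contributes the last w^(-1/2), which adds up to the exponent -(α +
1/2). -/
theorem hasSum_vgWeight_mul (hρ : Antitone ρ) (hm : 0 < ρ m) (t : ℝ) :
    HasSum (fun k => vgWeight m ρ k * (1 + (ρ m * t) ^ 2) ^ (-(vgOrder m k + 1 / 2)))
      (∏ i ∈ Finset.range (m + 1), (1 + ρ i ^ 2 * t ^ 2) ^ (-(1 / 2) : ℝ)) := by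
  set w : ℝ := 1 + (ρ m * t) ^ 2 with hw
  have hw1 : 1 ≤ w := by rw [hw]; linarith [sq_nonneg (ρ m * t)]
  have hw0 : 0 < w := by linarith
  have h : ∀ i : Fin m, HasSum (fun k : ℕ => w ^ (-(1 / 2) : ℝ) * (ρ m / ρ i) *
      (((2 * k).factorial : ℝ) / ((k.factorial : ℝ) ^ 2 * 4 ^ k) *
        ((1 - ρ m ^ 2 / ρ i ^ 2) / w) ^ k)) ((1 + ρ i ^ 2 * t ^ 2) ^ (-(1 / 2) : ℝ)) := by
    intro i
    have h1 : ρ m ≤ ρ i := hρ i.2.le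
    have h2 : 0 < ρ i := hm.trans_le h1
    obtain ⟨hu0, hu1⟩ := one_sub_sq_ratio_mem hρ hm i
    have hs := hasSum_central_mul_pow (u := (1 - ρ m ^ 2 / ρ i ^ 2) / w) (by positivity)
      (by rw [div_lt_one hw0]; linarith)
    convert! hs.mul_left (w ^ (-(1 / 2) : ℝ) * (ρ m / ρ i)) using 1
    have e1 : w * (1 - (1 - ρ m ^ 2 / ρ i ^ 2) / w) = (ρ m / ρ i) ^ 2 * (1 + ρ i ^ 2 * t ^ 2) := by
      rw [mul_sub, mul_div_cancel₀ _ hw0.ne', hw]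
      field_simp
      ring
    have e2 : 0 ≤ 1 - (1 - ρ m ^ 2 / ρ i ^ 2) / w := by
      rw [sub_nonneg, div_le_one hw0]; linarith
    have e3 : ((ρ m / ρ i) ^ 2) ^ (-(1 / 2) : ℝ) = (ρ m / ρ i)⁻¹ := by
      rw [← Real.rpow_natCast, ← Real.rpow_mul (by positivity)]
      norm_num
      rw [Real.rpow_neg_one, inv_div]
    rw [mul_right_comm, ← Real.mul_rpow hw0.le e2, e1, Real.mul_rpow (by positivity)
      (by positivity), e3]
    field_simp
  have hp := (hasSum_pi_prod (fun i k => ?_) h).mul_right (w ^ (-(1 / 2) : ℝ))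
  · rw [Finset.prod_range_succ, ← Fin.prod_univ_eq_prod_range
      (fun i => (1 + ρ i ^ 2 * t ^ 2) ^ (-(1 / 2) : ℝ)), ← mul_pow, ← hw]
    refine hp.congr_fun fun k => ?_
    rw [vgWeight, vgOrder, show -((m : ℝ) / 2 + ∑ i, (k i : ℝ) + 1 / 2)
      = (∑ i : Fin m, (-(1 / 2) + -(k i : ℝ))) + -(1 / 2) by
        rw [Finset.sum_add_distrib]; simp; ring, Real.rpow_add hw0, Real.rpow_sum_of_pos hw0,
      ← mul_assoc, ← Finset.prod_mul_distrib]
    congr 1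
    refine Finset.prod_congr rfl fun i _ => ?_
    rw [Real.rpow_add hw0, Real.rpow_neg hw0.le (k i : ℝ), Real.rpow_natCast, div_pow]
    ring
  · have h1 : ρ m ≤ ρ i := hρ i.2.le
    have h2 : 0 < ρ i := hm.trans_le h1
    obtain ⟨hu0, hu1⟩ := one_sub_sq_ratio_mem hρ hm i
    positivity

/-- At t = 0 the expansion of the characteristic function reads: the weights sum to 1. -/
theorem hasSum_vgWeight (hρ : Antitone ρ) (hm : 0 < ρ m) : HasSum (vgWeight m ρ) 1 := by
  simpa using hasSum_vgWeight_mul hρ hm 0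

/-- The mixture of scaled variance-gamma laws. -/
noncomputable def vgMixture (m : ℕ) (ρ : ℕ → ℝ) : Measure ℝ :=
  Measure.sum fun k : Fin m → ℕ => ENNReal.ofReal (vgWeight m ρ k) •
    (vgLaw (vgOrder m k + 1 / 2)).map (fun x => ρ m * x)

theorem isProbabilityMeasure_vgLaw_vgOrder (k : Fin m → ℕ) :
    IsProbabilityMeasure (vgLaw (vgOrder m k + 1 / 2)) :=
  isProbabilityMeasure_vgLaw (by linarith [vgOrder_nonneg m k])

theorem isProbabilityMeasure_vgMixture (hρ : Antitone ρ) (hm : 0 < ρ m) :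
    IsProbabilityMeasure (vgMixture m ρ) := by
  constructor
  have hk : ∀ k : Fin m → ℕ, (ENNReal.ofReal (vgWeight m ρ k) •
      (vgLaw (vgOrder m k + 1 / 2)).map (fun x => ρ m * x)) Set.univ
        = ENNReal.ofReal (vgWeight m ρ k) := fun k => by
    have := isProbabilityMeasure_vgLaw_vgOrder k
    rw [Measure.smul_apply, Measure.map_apply (by fun_prop) MeasurableSet.univ,
      Set.preimage_univ, measure_univ, smul_eq_mul, mul_one]
  rw [vgMixture, Measure.sum_apply _ MeasurableSet.univ]
  simp_rw [hk]
  rw [← ENNReal.ofReal_tsum_of_nonneg (vgWeight_nonneg hρ hm) (hasSum_vgWeight hρ hm).summable,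
    (hasSum_vgWeight hρ hm).tsum_eq, ENNReal.ofReal_one]

theorem charFun_vgMixture (hρ : Antitone ρ) (hm : 0 < ρ m) (t : ℝ) :
    charFun (vgMixture m ρ) t
      = (∏ i ∈ Finset.range (m + 1), (1 + ρ i ^ 2 * t ^ 2) ^ (-(1 / 2) : ℝ) : ℝ) := by
  have := isProbabilityMeasure_vgMixture hρ hm
  have hint : Integrable (fun x : ℝ => Complex.exp (t * x * Complex.I)) (vgMixture m ρ) := by
    refine (integrable_const (1 : ℝ)).mono' (by fun_prop) (Filter.Eventually.of_forall fun x => ?_)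
    rw [← Complex.ofReal_mul, Complex.norm_exp_ofReal_mul_I]
  rw [charFun_apply_real]
  have h := hasSum_integral_measure hint
  refine h.unique ?_
  refine (Complex.hasSum_ofReal.2 (hasSum_vgWeight_mul hρ hm t)).congr_fun fun k => ?_
  have hc := charFun_vgLaw (b := vgOrder m k + 1 / 2) (by linarith [vgOrder_nonneg m k]) (ρ m * t)
  rw [← charFun_map_mul, charFun_apply_real] at hc
  rw [integral_smul_measure, hc, ENNReal.toReal_ofReal (vgWeight_nonneg hρ hm k)]
  simp

theorem vgMixture_singleton (hm : 0 < ρ m) (x : ℝ) : vgMixture m ρ {x} = 0 := by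
  rw [vgMixture, Measure.sum_apply _ (measurableSet_singleton x), ENNReal.tsum_eq_zero]
  intro k
  rw [Measure.smul_apply, Measure.map_apply (by fun_prop) (measurableSet_singleton x)]
  have : (fun y => ρ m * y) ⁻¹' {x} = {x / ρ m} := by
    ext y
    simp only [Set.mem_preimage, Set.mem_singleton_iff]
    rw [eq_div_iff hm.ne', mul_comm]
  rw [this, vgLaw_singleton (vgOrder_nonneg m k), smul_zero]

/-- Each summand is the mass that one component of the mixture gives to (0, z]. Convergence is then
automatic, since the summands are nonnegative and the total mass is finite. -/
theorem hasSum_vTerm (hρ : Antitone ρ) (hm : 0 < ρ m) {z : ℝ} (hz : 0 ≤ z) :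
    HasSum (vTerm (m + 1) ρ z) ((vgMixture m ρ).real (Set.Ioc 0 z)) := by
  have := isProbabilityMeasure_vgMixture hρ hm
  have hpre : (fun y => ρ m * y) ⁻¹' Set.Ioc 0 z = Set.Ioc 0 (z / ρ m) := by
    ext y
    simp only [Set.mem_preimage, Set.mem_Ioc]
    rw [le_div_iff₀ hm, mul_comm y]
    simp [hm]
  have hne : vgMixture m ρ (Set.Ioc 0 z) ≠ ⊤ := measure_ne_top _ _
  rw [measureReal_def]
  rw [vgMixture, Measure.sum_apply _ measurableSet_Ioc] at hne ⊢
  have h := (ENNReal.summable_toReal hne).hasSum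
  rw [← ENNReal.tsum_toReal_eq (ENNReal.ne_top_of_tsum_ne_top hne)] at h
  refine h.congr_fun fun k => ?_
  rw [vTerm_succ, Measure.smul_apply, Measure.map_apply (by fun_prop) measurableSet_Ioc, hpre,
    smul_eq_mul, ENNReal.toReal_mul, ENNReal.toReal_ofReal (vgWeight_nonneg hρ hm k),
    ← vgLaw_Ioc (vgOrder_nonneg m k) (by positivity), measureReal_def]

end mixture

/-! ### Distribution functions of symmetric laws without atoms -/

section symmetric

variable {ν : Measure ℝ} [IsProbabilityMeasure ν]

theorem map_neg_eq_of_charFun {φ : ℝ → ℝ} (h : ∀ t, charFun ν t = φ t) (hφ : ∀ t, φ (-t) = φ t) :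
    ν.map (fun x => -x) = ν := by
  have : IsProbabilityMeasure (ν.map fun x => -x) :=
    Measure.isProbabilityMeasure_map (by fun_prop)
  refine Measure.ext_of_charFun (funext fun t => ?_)
  have := charFun_map_mul (μ := ν) (-1) t
  simp only [neg_mul, one_mul] at this
  rw [this, h, h, hφ]

/-- Reflection turns the lower tail into a closed upper tail; without atoms the endpoint may be
dropped, so the complement can be taken. -/
theorem real_Iic_neg (hsymm : ν.map (fun x => -x) = ν) (hatom : ∀ x, ν {x} = 0) (x : ℝ) :
    ν.real (Set.Iic (-x)) = 1 - ν.real (Set.Iic x) := by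
  have h1 : ν (Set.Iic (-x)) = ν (Set.Ici x) := by
    conv_lhs => rw [← hsymm]
    rw [Measure.map_apply (by fun_prop) measurableSet_Iic]
    congr 1
    ext y; simp
  have h2 : ν (Set.Ici x) = ν (Set.Ioi x) := (measure_congr (Ioi_ae_eq_Ici' (hatom x))).symm
  rw [measureReal_def, h1, h2, ← measureReal_def, ← Set.compl_Iic,
    probReal_compl_eq_one_sub measurableSet_Iic]

theorem real_Iic_of_nonneg (hsymm : ν.map (fun x => -x) = ν) (hatom : ∀ x, ν {x} = 0) {x : ℝ}
    (hx : 0 ≤ x) : ν.real (Set.Iic x) = 1 / 2 + ν.real (Set.Ioc 0 x) := by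
  have h0 := real_Iic_neg hsymm hatom 0
  rw [neg_zero] at h0
  rw [← Set.Iic_union_Ioc_eq_Iic hx, measureReal_union (by
    rw [Set.disjoint_left]; intro y hy hy'; exact absurd hy'.1 (not_lt.2 hy)) measurableSet_Ioc]
  linarith

end symmetric

/-- The distribution function of a law with characteristic function `∏ (1 + ρᵢ² t²)^(-1/2)`. -/
theorem cdf_eq_of_charFun {ν : Measure ℝ} [IsProbabilityMeasure ν] {r : ℕ} {ρ : ℕ → ℝ}
    (hr : 1 ≤ r) (hρ : Antitone ρ) (hpos : 0 < ρ (r - 1))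
    (hν : ∀ t, charFun ν t
      = (∏ i ∈ Finset.range r, (1 + ρ i ^ 2 * t ^ 2) ^ (-(1 / 2) : ℝ) : ℝ)) :
    (∀ z : ℝ, 0 ≤ z → Summable (vTerm r ρ z)) ∧
      ∀ x, ν.real (Set.Iic x) = if x ≤ 0 then 1 / 2 - vFun r ρ (-x) else 1 / 2 + vFun r ρ x := by
  obtain ⟨m, rfl⟩ : ∃ m, r = m + 1 := ⟨r - 1, by omega⟩
  have hm : 0 < ρ m := hpos
  have := isProbabilityMeasure_vgMixture hρ hm
  have he : ν = vgMixture m ρ :=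
    Measure.ext_of_charFun (funext fun t => by rw [hν, charFun_vgMixture hρ hm])
  have hsymm : ν.map (fun x => -x) = ν := map_neg_eq_of_charFun hν fun t => by simp
  have hatom : ∀ x, ν {x} = 0 := fun x => by rw [he]; exact vgMixture_singleton hm x
  have hV : ∀ z : ℝ, 0 ≤ z → ν.real (Set.Ioc 0 z) = vFun (m + 1) ρ z := fun z hz => by
    rw [he]; exact (hasSum_vTerm hρ hm hz).tsum_eq.symm
  refine ⟨fun z hz => (hasSum_vTerm hρ hm hz).summable, fun x => ?_⟩
  split_ifs with hx
  · have h := real_Iic_neg hsymm hatom (-x)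
    rw [neg_neg, real_Iic_of_nonneg hsymm hatom (x := -x) (by linarith), hV (-x) (by linarith)] at h
    rw [h]; ring
  · rw [real_Iic_of_nonneg hsymm hatom (by linarith), hV _ (by linarith)]

/-! ### Singular values and the Hermitian dilation -/

section dilation

variable {p q : ℕ}

theorem Matrix.IsHermitian.det_one_sub_smul {n : Type*} [Fintype n] [DecidableEq n]
    {A : Matrix n n ℝ} (hA : A.IsHermitian) (x : ℝ) :
    (1 - x • A).det = ∏ i, (1 - x * hA.eigenvalues i) := by
  have h1 : (hA.eigenvectorUnitary : Matrix n n ℝ) * star (hA.eigenvectorUnitary : Matrix n n ℝ)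
    = 1 := Unitary.coe_mul_star_self _
  have h2 : (1 - x • A) = (hA.eigenvectorUnitary : Matrix n n ℝ) *
      Matrix.diagonal (fun i => 1 - x * hA.eigenvalues i) *
        star (hA.eigenvectorUnitary : Matrix n n ℝ) := by
    have h3 : Matrix.diagonal (fun i => 1 - x * hA.eigenvalues i)
        = 1 - x • Matrix.diagonal (RCLike.ofReal ∘ hA.eigenvalues) := by
      ext i j
      by_cases hij : i = j <;> simp [Matrix.diagonal, hij]
    conv_lhs => rw [hA.spectral_theorem, Unitary.conjStarAlgAut_apply]
    rw [h3, mul_sub, sub_mul, mul_one, h1, Matrix.mul_smul, Matrix.smul_mul]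
  rw [h2, Matrix.det_mul_right_comm, h1, one_mul, Matrix.det_diagonal]

/-- In an eigenbasis of the adjoint of T composed with T, the operator is diagonal with entries 1 -
s σ_i². Indices beyond the rank have σ_i = 0 and contribute the factor 1. -/
theorem det_one_sub_smul_transpose_mul_self (M : Matrix (Fin p) (Fin q) ℝ) (s : ℝ) :
    (1 - s • (M.transpose * M)).det
      = ∏ i ∈ Finset.range M.rank, (1 - s * (Matrix.toEuclideanLin M).singularValues i ^ 2) := by
  set T := Matrix.toEuclideanLin M with hT
  have hq : Module.finrank ℝ (EuclideanSpace ℝ (Fin q)) = q := by simp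
  have hrank : Module.finrank ℝ T.range = M.rank := by
    rw [Matrix.rank_eq_finrank_range_toLin M (PiLp.basisFun 2 ℝ (Fin p)) (PiLp.basisFun 2 ℝ (Fin q))]
    rfl
  have hle : M.rank ≤ q := by simpa using M.rank_le_width
  have hS := T.isSymmetric_adjoint_comp_self
  have h0 : ∏ i ∈ Finset.range M.rank, (1 - s * T.singularValues i ^ 2)
      = ∏ i ∈ Finset.range q, (1 - s * T.singularValues i ^ 2) := by
    refine Finset.prod_subset (Finset.range_subset_range.2 hle) fun i _ hi => ?_
    have : T.singularValues i = 0 := by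
      rw [LinearMap.singularValues_eq_zero_iff_le_finrank_range, hrank]
      simpa using hi
    simp [this]
  rw [h0, ← Fin.prod_univ_eq_prod_range (fun i => 1 - s * T.singularValues i ^ 2)]
  have h1 : LinearMap.det (1 - s • (LinearMap.adjoint T ∘ₗ T))
      = ∏ i : Fin q, (1 - s * T.singularValues i ^ 2) := by
    set b := (hS.eigenvectorBasis hq).toBasis
    rw [← LinearMap.det_toMatrix b, ← Matrix.det_diagonal]
    congr 1
    refine LinearMap.toMatrix b b |>.symm.injective ?_
    refine b.ext fun i => ?_
    rw [LinearEquiv.symm_apply_apply, LinearMap.toMatrix_symm, Matrix.toLin_self]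
    have := hS.apply_eigenvectorBasis hq i
    have hb : b i = hS.eigenvectorBasis hq i := by simp [b]
    simp only [Matrix.diagonal_apply, ite_smul, zero_smul, Finset.sum_ite_eq', Finset.mem_univ,
      if_true, LinearMap.sub_apply, LinearMap.smul_apply, Module.End.one_apply, hb, this]
    rw [← T.sq_singularValues_fin hq, sub_smul, one_smul, mul_smul]
    rfl
  rw [← h1]
  have h2 : (1 : EuclideanSpace ℝ (Fin q) →ₗ[ℝ] EuclideanSpace ℝ (Fin q)) -
      s • (LinearMap.adjoint T ∘ₗ T) = Matrix.toEuclideanLin (1 - s • (M.transpose * M)) := by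
    rw [hT, ← Matrix.toEuclideanLin_conjTranspose_eq_adjoint]
    ext v i
    simp [Matrix.toLpLin_apply, Matrix.mulVec_mulVec]
  rw [h2, Matrix.toEuclideanLin, Matrix.toLpLin_eq_toLin, LinearMap.det_toLin]

/-- The Hermitian dilation of a real matrix. -/
def hermDilation (M : Matrix (Fin p) (Fin q) ℝ) : Matrix (Fin p ⊕ Fin q) (Fin p ⊕ Fin q) ℝ :=
  Matrix.fromBlocks 0 M M.transpose 0

theorem isHermitian_hermDilation (M : Matrix (Fin p) (Fin q) ℝ) : (hermDilation M).IsHermitian := by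
  rw [hermDilation, Matrix.IsHermitian, Matrix.fromBlocks_conjTranspose]
  simp

/-- The diagonal blocks vanish, hence so does the trace. This makes the centring of the
log-likelihood ratio exact in `integral_cexp_logRatio`. -/
theorem sum_eigenvalues_hermDilation (M : Matrix (Fin p) (Fin q) ℝ) :
    ∑ j, (isHermitian_hermDilation M).eigenvalues j = 0 := by
  have h := (isHermitian_hermDilation M).trace_eq_sum_eigenvalues
  have h0 : (hermDilation M).trace = 0 := by simp [hermDilation, Matrix.trace]
  rw [h0] at h
  exact_mod_cast h.symm

/-- A Schur complement reduces the block determinant to that of 1 - x² Mᵀ M. The ± pairing of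
eigenvalues is thus used without being exhibited. -/
theorem prod_one_sub_eigenvalues_hermDilation (M : Matrix (Fin p) (Fin q) ℝ) (x : ℝ) :
    ∏ j, (1 - x * (isHermitian_hermDilation M).eigenvalues j)
      = ∏ i ∈ Finset.range M.rank,
          (1 - x ^ 2 * (Matrix.toEuclideanLin M).singularValues i ^ 2) := by
  rw [← Matrix.IsHermitian.det_one_sub_smul, ← det_one_sub_smul_transpose_mul_self]
  have : 1 - x • hermDilation M = Matrix.fromBlocks 1 (-x • M) (-x • M.transpose) 1 := by
    rw [hermDilation, ← Matrix.fromBlocks_one, Matrix.fromBlocks_smul, sub_eq_add_neg,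
      Matrix.fromBlocks_neg, Matrix.fromBlocks_add]
    simp
  rw [this, Matrix.det_fromBlocks_one₁₁, Matrix.smul_mul, Matrix.mul_smul, smul_smul]
  ring_nf

theorem prod_one_sub_I_mul_eigenvalues_hermDilation (M : Matrix (Fin p) (Fin q) ℝ) (t : ℝ) :
    ∏ j, (1 - (t * (isHermitian_hermDilation M).eigenvalues j : ℝ) * Complex.I)
      = (∏ i ∈ Finset.range M.rank,
          (1 + (Matrix.toEuclideanLin M).singularValues i ^ 2 * t ^ 2) : ℝ) := by
  -- An identity at all real x is an identity of polynomials, and may be evaluated at x = i t.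
  have h : (∏ j, (1 - Polynomial.X *
      Polynomial.C ((isHermitian_hermDilation M).eigenvalues j)) : Polynomial ℝ)
      = ∏ i ∈ Finset.range M.rank, (1 - Polynomial.X ^ 2 *
        Polynomial.C ((Matrix.toEuclideanLin M).singularValues i ^ 2)) := by
    refine Polynomial.funext fun x => ?_
    simpa [Polynomial.eval_prod, mul_comm x] using prod_one_sub_eigenvalues_hermDilation M x
  have h2 := congrArg (Polynomial.aeval (t * Complex.I : ℂ)) h
  simp only [map_prod, map_sub, map_one, map_mul, map_pow, Polynomial.aeval_X,
    Polynomial.aeval_C] at h2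
  push_cast
  convert! h2 using 1
  · refine Finset.prod_congr rfl fun j _ => ?_
    simp only [Complex.coe_algebraMap]
    ring
  · refine Finset.prod_congr rfl fun j _ => ?_
    rw [mul_pow, Complex.I_sq]
    simp
    ring

/-- The product of the factors `(1 - i l_j t)^(-1/2)` over the eigenvalues `l_j` of the Hermitian
dilation, in terms of the singular values. -/
theorem prod_cpow_eigenvalues_hermDilation (M : Matrix (Fin p) (Fin q) ℝ) (t : ℝ) :
    ∏ j, (1 - (t * (isHermitian_hermDilation M).eigenvalues j : ℝ) * Complex.I) ^ (-(1 / 2) : ℂ)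
      = (∏ i ∈ Finset.range M.rank,
          (1 + (Matrix.toEuclideanLin M).singularValues i ^ 2 * t ^ 2) ^ (-(1 / 2) : ℝ) : ℝ) := by
  set l := (isHermitian_hermDilation M).eigenvalues with hl
  set σ := (Matrix.toEuclideanLin M).singularValues
  have hslit : ∀ (t : ℝ) j, (1 - (t * l j : ℝ) * Complex.I) ∈ Complex.slitPlane := fun t j => by
    left; simp
  have hf : Continuous fun t : ℝ =>
      ∏ j, (1 - (t * l j : ℝ) * Complex.I) ^ (-(1 / 2) : ℂ) := by
    refine continuous_finsetProd _ fun j _ => ?_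
    refine Continuous.cpow (by fun_prop) continuous_const fun t => hslit t j
  have hpos : ∀ (t : ℝ) i, 0 < 1 + σ i ^ 2 * t ^ 2 := fun t i => by positivity
  have hg : Continuous fun t : ℝ =>
      ((∏ i ∈ Finset.range M.rank, (1 + σ i ^ 2 * t ^ 2) ^ (-(1 / 2) : ℝ) : ℝ) : ℂ) := by
    refine Complex.continuous_ofReal.comp (continuous_finsetProd _ fun i _ => ?_)
    exact Continuous.rpow_const (by fun_prop) fun t => Or.inl (hpos t i).ne'
  -- Complex powers need not be multiplicative, so branches are matched by continuity: both sides
  -- are continuous in t, have equal squares, agree at t = 0, and the right side never vanishes.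
  have h := isPreconnected_univ.eq_of_sq_eq hf.continuousOn hg.continuousOn ?_ ?_
    (Set.mem_univ (0 : ℝ)) (by simp)
  · exact h (Set.mem_univ t)
  · intro t _
    simp only [Pi.pow_apply]
    rw [← Complex.ofReal_pow, ← Finset.prod_pow, ← Finset.prod_pow]
    have h1 : ∀ j, ((1 - (t * l j : ℝ) * Complex.I) ^ (-(1 / 2) : ℂ)) ^ 2
        = (1 - (t * l j : ℝ) * Complex.I)⁻¹ := fun j => by
      rw [← Complex.cpow_nat_mul]
      norm_num
      rw [Complex.cpow_neg_one]
    have h2 : ∀ i, ((1 + σ i ^ 2 * t ^ 2) ^ (-(1 / 2) : ℝ)) ^ 2 = (1 + σ i ^ 2 * t ^ 2)⁻¹ :=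
      fun i => by
        rw [← Real.rpow_natCast, ← Real.rpow_mul (hpos t i).le]
        norm_num
        rw [Real.rpow_neg_one]
    simp_rw [h1, h2]
    rw [Finset.prod_inv_distrib, Finset.prod_inv_distrib,
      prod_one_sub_I_mul_eigenvalues_hermDilation, Complex.ofReal_inv]
  · intro t _
    rw [Complex.ofReal_ne_zero]
    exact Finset.prod_ne_zero_iff.2 fun i _ => (Real.rpow_pos_of_pos (hpos t i) _).ne'

end dilation

/-! ### Densities of centred Gaussian laws with respect to the standard one -/

/-- The density of `N(0, v)` with respect to `N(0, 1)`. -/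
noncomputable def gaussRatio (v x : ℝ) : ℝ := (√v)⁻¹ * Real.exp (x ^ 2 / 2 * (1 - 1 / v))

theorem gaussRatio_pos {v : ℝ} (hv : 0 < v) (x : ℝ) : 0 < gaussRatio v x := by
  rw [gaussRatio]; positivity

theorem measurable_gaussRatio (v : ℝ) : Measurable (gaussRatio v) := by
  unfold gaussRatio; fun_prop

theorem log_gaussRatio {v : ℝ} (hv : 0 < v) (x : ℝ) :
    Real.log (gaussRatio v x) = -(1 / 2) * Real.log v + x ^ 2 / 2 * (1 - 1 / v) := by
  rw [gaussRatio, Real.log_mul (by positivity) (Real.exp_pos _).ne', Real.log_exp, Real.log_inv,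
    Real.log_sqrt hv.le]
  ring

theorem gaussianReal_eq_withDensity_gaussRatio {v : ℝ} (hv : 0 < v) :
    gaussianReal 0 v.toNNReal
      = (gaussianReal 0 1).withDensity fun x => ENNReal.ofReal (gaussRatio v x) := by
  rw [gaussianReal_of_var_ne_zero _ (by simpa using hv), gaussianReal_of_var_ne_zero _ one_ne_zero,
    ← withDensity_mul _ (measurable_gaussianPDF 0 1) (measurable_gaussRatio v).ennreal_ofReal]
  congr 1
  ext x
  simp only [Pi.mul_apply, gaussianPDF]
  rw [← ENNReal.ofReal_mul (gaussianPDFReal_nonneg _ _ _)]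
  congr 1
  simp only [gaussianPDFReal, gaussRatio, Real.coe_toNNReal _ hv.le, NNReal.coe_one, mul_one,
    sub_zero]
  rw [Real.sqrt_mul (by positivity) v, mul_inv, mul_mul_mul_comm, ← Real.exp_add]
  congr 2
  field_simp
  ring

/-- It suffices to compare boxes, where the integrand is a product of functions of independent
coordinates. -/
theorem pi_gaussianReal_eq_withDensity {ι : Type*} [Fintype ι] {v : ι → ℝ} (hv : ∀ j, 0 < v j) :
    Measure.pi (fun j => gaussianReal 0 (v j).toNNReal)
      = (Measure.pi fun _ : ι => gaussianReal 0 1).withDensity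
          fun x => ∏ j, ENNReal.ofReal (gaussRatio (v j) (x j)) := by
  refine (Measure.pi_eq fun s hs => ?_)
  rw [withDensity_apply _ (MeasurableSet.univ_pi hs),
    ← lintegral_indicator (MeasurableSet.univ_pi hs)]
  have h1 : ∀ x : ι → ℝ, (Set.univ.pi s).indicator
      (fun x => ∏ j, ENNReal.ofReal (gaussRatio (v j) (x j))) x
        = ∏ j, (s j).indicator (fun y => ENNReal.ofReal (gaussRatio (v j) y)) (x j) := by
    intro x
    by_cases hx : x ∈ Set.univ.pi s
    · rw [Set.indicator_of_mem hx]
      exact Finset.prod_congr rfl fun j _ => by rw [Set.indicator_of_mem (hx j (Set.mem_univ j))]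
    · rw [Set.indicator_of_notMem hx]
      simp only [Set.mem_univ_pi, not_forall] at hx
      obtain ⟨j, hj⟩ := hx
      exact (Finset.prod_eq_zero (Finset.mem_univ j) (Set.indicator_of_notMem hj _)).symm
  have hmeas : ∀ j, Measurable ((s j).indicator fun y => ENNReal.ofReal (gaussRatio (v j) y)) :=
    fun j => (measurable_gaussRatio (v j)).ennreal_ofReal.indicator (hs j)
  simp_rw [h1]
  rw [lintegral_prod_eq_prod_lintegral_of_indepFun Finset.univ _
    (iIndepFun_pi fun j => (hmeas j).aemeasurable)
    (fun j => (hmeas j).comp (measurable_pi_apply j))]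
  refine Finset.prod_congr rfl fun j _ => ?_
  rw [gaussianReal_eq_withDensity_gaussRatio (hv j), withDensity_apply _ (hs j),
    ← lintegral_indicator (hs j)]
  have := (measurePreserving_eval (fun _ : ι => gaussianReal 0 1) j).lintegral_comp (hmeas j)
  exact this

theorem integral_cexp_sq_gaussianReal {v : ℝ} (hv : 0 < v) (t : ℝ) :
    ∫ x, Complex.exp (t * (x ^ 2 / 2 * (1 - 1 / v) : ℝ) * Complex.I) ∂gaussianReal 0 v.toNNReal
      = (1 - (t * (v - 1) : ℝ) * Complex.I) ^ (-(1 / 2) : ℂ) := by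
  rw [integral_gaussianReal_eq_integral_smul (by simpa using hv)]
  have hvC : (v : ℂ) ≠ 0 := by exact_mod_cast hv.ne'
  set w : ℂ := 1 - (t * (v - 1) : ℝ) * Complex.I with hw
  have hwre : w.re = 1 := by simp [hw]
  have hw0 : w ≠ 0 := fun h => by simp [h] at hwre
  -- The Gaussian exponent -x²/(2v) and the oscillating exponent combine to -b x². As w has real
  -- part 1, b lies in the right half-plane and w avoids the branch cut.
  set b : ℂ := w / (2 * v) with hb
  have hbre : 0 < b.re := by
    have : b = ((1 / (2 * v) : ℝ) : ℂ) * w := by rw [hb]; push_cast; field_simp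
    rw [this, Complex.re_ofReal_mul, hwre]
    positivity
  have h1 : ∀ x : ℝ, gaussianPDFReal 0 v.toNNReal x •
      Complex.exp (t * (x ^ 2 / 2 * (1 - 1 / v) : ℝ) * Complex.I)
        = ((√(2 * Real.pi * v))⁻¹ : ℝ) * Complex.exp (-b * (x : ℂ) ^ 2) := by
    intro x
    rw [gaussianPDFReal, Real.coe_toNNReal _ hv.le, Complex.real_smul, Complex.ofReal_mul, mul_assoc,
      Complex.ofReal_exp, ← Complex.exp_add]
    congr 2
    rw [hb, hw]
    push_cast
    field_simp
    ring
  simp_rw [h1]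
  rw [integral_const_mul, integral_gaussian_complex hbre]
  have h2 : (Real.pi : ℂ) / b = ((2 * Real.pi * v : ℝ) : ℂ) * w⁻¹ := by
    rw [hb]; push_cast; field_simp
  have hpos : 0 < 2 * Real.pi * v := by positivity
  have hmul : (((2 * Real.pi * v : ℝ) : ℂ) * w⁻¹) ^ (1 / 2 : ℂ)
      = ((2 * Real.pi * v : ℝ) : ℂ) ^ (1 / 2 : ℂ) * (w⁻¹) ^ (1 / 2 : ℂ) := by
    have hp : ((2 * Real.pi * v : ℝ) : ℂ) ≠ 0 := by exact_mod_cast hpos.ne'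
    rw [Complex.cpow_def_of_ne_zero (mul_ne_zero hp (inv_ne_zero hw0)),
      Complex.cpow_def_of_ne_zero hp, Complex.cpow_def_of_ne_zero (inv_ne_zero hw0),
      Complex.log_ofReal_mul hpos (inv_ne_zero hw0), ← Complex.exp_add, Complex.ofReal_log hpos.le]
    ring_nf
  have harg : w.arg ≠ Real.pi := by
    intro h
    rw [Complex.arg_eq_pi_iff] at h
    linarith [h.1]
  have hsq : ((2 * Real.pi * v : ℝ) : ℂ) ^ (1 / 2 : ℂ) = (√(2 * Real.pi * v) : ℝ) := by
    rw [Real.sqrt_eq_rpow, Complex.ofReal_cpow hpos.le]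
    norm_num
  rw [h2, hmul, hsq, Complex.inv_cpow _ _ harg, Complex.cpow_neg, ← mul_assoc,
    ← Complex.ofReal_mul, inv_mul_cancel₀ (by positivity), Complex.ofReal_one, one_mul]

theorem integrable_sq_gaussianReal (v : NNReal) :
    Integrable (fun x : ℝ => x ^ 2) (gaussianReal 0 v) :=
  (memLp_id_gaussianReal 2).integrable_sq

theorem integral_sq_gaussianReal (v : NNReal) :
    ∫ x, x ^ 2 ∂gaussianReal 0 v = v := by
  have h := variance_id_gaussianReal (μ := 0) (v := v)
  rw [variance_eq_integral aemeasurable_id] at h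
  simpa only [id_eq, integral_id_gaussianReal, sub_zero] using h

theorem integrable_log_gaussRatio {v : ℝ} (hv : 0 < v) :
    Integrable (fun x => Real.log (gaussRatio v x)) (gaussianReal 0 v.toNNReal) := by
  simp_rw [log_gaussRatio hv]
  exact (integrable_const _).add (((integrable_sq_gaussianReal _).div_const 2).mul_const _)

theorem integral_log_gaussRatio {v : ℝ} (hv : 0 < v) :
    ∫ x, Real.log (gaussRatio v x) ∂gaussianReal 0 v.toNNReal
      = -(1 / 2) * Real.log v + (v - 1) / 2 := by
  have h0 := hv.ne'
  simp_rw [log_gaussRatio hv]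
  rw [integral_add (integrable_const _) (((integrable_sq_gaussianReal _).div_const 2).mul_const _),
    integral_const, integral_mul_const, integral_div, integral_sq_gaussianReal,
    Real.coe_toNNReal _ hv.le]
  simp
  field_simp

/-! ### The log-likelihood ratio of centred Gaussian product laws -/

section loglikelihood

variable {ι : Type*} [Fintype ι] {v : ι → ℝ}

/-- The sum of the logarithms of the coordinate densities. -/
noncomputable def logRatio (v : ι → ℝ) (x : ι → ℝ) : ℝ := ∑ j, Real.log (gaussRatio (v j) (x j))

theorem measurable_logRatio (v : ι → ℝ) : Measurable (logRatio v) :=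
  Finset.measurable_sum _ fun j _ =>
    ((measurable_gaussRatio (v j)).comp (measurable_pi_apply j)).log

theorem integrable_log_gaussRatio_eval (hv : ∀ j, 0 < v j) (j : ι) :
    Integrable (fun x : ι → ℝ => Real.log (gaussRatio (v j) (x j)))
      (Measure.pi fun j => gaussianReal 0 (v j).toNNReal) :=
  integrable_comp_eval (μ := fun j => gaussianReal 0 (v j).toNNReal)
    (integrable_log_gaussRatio (hv j))

theorem integrable_logRatio (hv : ∀ j, 0 < v j) :
    Integrable (logRatio v) (Measure.pi fun j => gaussianReal 0 (v j).toNNReal) :=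
  integrable_finsetSum _ fun j _ => integrable_log_gaussRatio_eval hv j

theorem integral_logRatio (hv : ∀ j, 0 < v j) :
    ∫ x, logRatio v x ∂(Measure.pi fun j => gaussianReal 0 (v j).toNNReal)
      = ∑ j, (-(1 / 2) * Real.log (v j) + (v j - 1) / 2) := by
  unfold logRatio
  rw [integral_finsetSum _ fun j _ => integrable_log_gaussRatio_eval hv j]
  refine Finset.sum_congr rfl fun j _ => ?_
  rw [← integral_log_gaussRatio (hv j)]
  exact integral_comp_eval (μ := fun j => gaussianReal 0 (v j).toNNReal)
    (integrable_log_gaussRatio (hv j)).aestronglyMeasurable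

/-- The mean is the sum of the logarithmic constants plus half of ∑ (v_j - 1). The latter vanishes
by `hs`, so centring removes exactly the constants and leaves a product of one-dimensional
integrals. -/
theorem integral_cexp_logRatio (hv : ∀ j, 0 < v j) (hs : ∑ j, (v j - 1) = 0) (t : ℝ) :
    ∫ x, Complex.exp (t * (logRatio v x - ∫ y, logRatio v y
        ∂(Measure.pi fun j => gaussianReal 0 (v j).toNNReal) : ℝ) * Complex.I)
      ∂(Measure.pi fun j => gaussianReal 0 (v j).toNNReal)
      = ∏ j, (1 - (t * (v j - 1) : ℝ) * Complex.I) ^ (-(1 / 2) : ℂ) := by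
  rw [integral_logRatio hv]
  simp_rw [← integral_cexp_sq_gaussianReal (hv _) t]
  rw [← integral_fintype_prod_eq_prod (f := fun j (x : ℝ) =>
    Complex.exp (t * (x ^ 2 / 2 * (1 - 1 / v j) : ℝ) * Complex.I))]
  congr 1
  ext x
  rw [← Complex.exp_sum, ← Finset.sum_mul, ← Finset.mul_sum, ← Complex.ofReal_sum]
  congr 4
  have hs2 : ∑ j, (v j - 1) / 2 = 0 := by rw [← Finset.sum_div, hs, zero_div]
  rw [Finset.sum_add_distrib, hs2, add_zero, logRatio, ← Finset.sum_sub_distrib]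
  exact Finset.sum_congr rfl fun j _ => by rw [log_gaussRatio (hv j)]; ring

end loglikelihood

/-! ### Whitening of Gaussian measures -/

section whitening

variable {p q : ℕ}

/-- The concatenation of two vectors. -/
def stackVec (z : (Fin p → ℝ) × (Fin q → ℝ)) : Fin p ⊕ Fin q → ℝ := Sum.elim z.1 z.2

theorem continuous_stackVec : Continuous (stackVec : (Fin p → ℝ) × (Fin q → ℝ) → _) := by
  refine continuous_pi fun i => ?_
  rcases i with i | i
  · exact (continuous_apply i).comp continuous_fst
  · exact (continuous_apply i).comp continuous_snd

/-- Concatenation of vectors followed by a linear map, as a continuous linear map. -/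
noncomputable def stackCLM (C : Matrix (Fin p ⊕ Fin q) (Fin p ⊕ Fin q) ℝ) :
    (Fin p → ℝ) × (Fin q → ℝ) →L[ℝ] (Fin p ⊕ Fin q → ℝ) where
  toFun z := C.mulVec (stackVec z)
  map_add' x y := by
    rw [← Matrix.mulVec_add]; congr 1; ext i; rcases i with i | i <;> rfl
  map_smul' c x := by
    rw [RingHom.id_apply, ← Matrix.mulVec_smul]; congr 1; ext i; rcases i with i | i <;> rfl
  cont := Continuous.matrix_mulVec continuous_const continuous_stackVec

/-- The covariance matrix of a measure on a product of two Euclidean spaces. -/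
noncomputable def covStack (μ : Measure ((Fin p → ℝ) × (Fin q → ℝ))) :
    Matrix (Fin p ⊕ Fin q) (Fin p ⊕ Fin q) ℝ :=
  Matrix.of fun i j => cov[fun z => stackVec z i, fun z => stackVec z j; μ]

/-- The affine map `z ↦ C (z - m)`. -/
def whiten (C : Matrix (Fin p ⊕ Fin q) (Fin p ⊕ Fin q) ℝ) (m : Fin p ⊕ Fin q → ℝ)
    (z : (Fin p → ℝ) × (Fin q → ℝ)) : Fin p ⊕ Fin q → ℝ :=
  C.mulVec (stackVec z - m)

theorem continuous_whiten (C : Matrix (Fin p ⊕ Fin q) (Fin p ⊕ Fin q) ℝ)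
    (m : Fin p ⊕ Fin q → ℝ) : Continuous (whiten C m) :=
  Continuous.matrix_mulVec continuous_const (continuous_stackVec.sub continuous_const)

theorem measurableEmbedding_whiten {C : Matrix (Fin p ⊕ Fin q) (Fin p ⊕ Fin q) ℝ}
    (hC : IsUnit C) (m : Fin p ⊕ Fin q → ℝ) : MeasurableEmbedding (whiten C m) := by
  refine (continuous_whiten C m).measurableEmbedding fun x y h => ?_
  have h2 := sub_left_injective (Matrix.mulVec_injective_of_isUnit hC h)
  refine Prod.ext (funext fun i => ?_) (funext fun i => ?_)
  · exact congrFun h2 (Sum.inl i)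
  · exact congrFun h2 (Sum.inr i)

variable {μ : Measure ((Fin p → ℝ) × (Fin q → ℝ))} [IsGaussian μ]

theorem memLp_stackVec (i : Fin p ⊕ Fin q) : MemLp (fun z => stackVec z i) 2 μ := by
  have h : HasGaussianLaw (fun z => stackCLM 1 z) μ :=
    (IsGaussian.hasGaussianLaw_id (μ := μ)).map (stackCLM 1)
  have := (h.eval i).memLp_two
  simpa [stackCLM] using this

theorem hasGaussianLaw_whiten (C : Matrix (Fin p ⊕ Fin q) (Fin p ⊕ Fin q) ℝ)
    (m : Fin p ⊕ Fin q → ℝ) : HasGaussianLaw (whiten C m) μ where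
  isGaussian_map := by
    have h : whiten C m = (fun x => x - C.mulVec m) ∘ stackCLM C := by
      ext1 z
      simp [whiten, stackCLM, Matrix.mulVec_sub]
    rw [h, ← Measure.map_map (by fun_prop) (by fun_prop)]
    infer_instance

theorem covariance_whiten (C : Matrix (Fin p ⊕ Fin q) (Fin p ⊕ Fin q) ℝ)
    (m : Fin p ⊕ Fin q → ℝ) (i j : Fin p ⊕ Fin q) :
    cov[fun z => whiten C m z i, fun z => whiten C m z j; μ]
      = (C * covStack μ * C.transpose) i j := by
  have hmem : ∀ i k, MemLp (fun z => C i k * (stackVec z k - m k)) 2 μ := fun i k =>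
    ((memLp_stackVec k).sub (memLp_const (m k))).const_mul (C i k)
  have hint : ∀ k, Integrable (fun z => stackVec z k) μ := fun k =>
    (memLp_stackVec k).integrable one_le_two
  have h : ∀ i, (fun z => whiten C m z i) = fun z => ∑ k, C i k * (stackVec z k - m k) :=
    fun i => rfl
  rw [h i, h j, covariance_fun_sum_fun_sum (hmem i) (hmem j), Matrix.mul_apply, Finset.sum_comm]
  refine Finset.sum_congr rfl fun l _ => ?_
  rw [Matrix.mul_apply, Finset.sum_mul]
  refine Finset.sum_congr rfl fun k _ => ?_
  rw [covariance_const_mul_left, covariance_const_mul_right, covariance_sub_const_left (hint k),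
    covariance_sub_const_right (hint l)]
  simp only [covStack, Matrix.of_apply, Matrix.transpose_apply]
  ring

theorem integral_whiten (C : Matrix (Fin p ⊕ Fin q) (Fin p ⊕ Fin q) ℝ)
    {m : Fin p ⊕ Fin q → ℝ} (hm : ∀ i, m i = ∫ z, stackVec z i ∂μ) (i : Fin p ⊕ Fin q) :
    ∫ z, whiten C m z i ∂μ = 0 := by
  have hint : ∀ k, Integrable (fun z => stackVec z k) μ := fun k =>
    (memLp_stackVec k).integrable one_le_two
  have hint2 : ∀ k, Integrable (fun z => C i k * (stackVec z k - m k)) μ := fun k =>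
    ((hint k).sub (integrable_const _)).const_mul _
  change ∫ z, ∑ k, C i k * (stackVec z k - m k) ∂μ = 0
  rw [integral_finsetSum _ fun k _ => hint2 k]
  refine Finset.sum_eq_zero fun k _ => ?_
  rw [integral_const_mul, integral_sub (hint k) (integrable_const _), integral_const, ← hm]
  simp

/-- For a Gaussian vector a diagonal covariance matrix means independent coordinates, so means and
variances determine the image law. -/
theorem map_whiten {C : Matrix (Fin p ⊕ Fin q) (Fin p ⊕ Fin q) ℝ} {m v : Fin p ⊕ Fin q → ℝ}
    (hm : ∀ i, m i = ∫ z, stackVec z i ∂μ)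
    (hC : C * covStack μ * C.transpose = Matrix.diagonal v) :
    μ.map (whiten C m) = Measure.pi fun j => gaussianReal 0 (v j).toNNReal := by
  have hG := hasGaussianLaw_whiten (μ := μ) C m
  have hind : iIndepFun (fun j z => whiten C m z j) μ :=
    hG.iIndepFun_of_covariance_eq_zero fun i j hij => by
      rw [covariance_whiten, hC, Matrix.diagonal_apply_ne _ hij]
  rw [show whiten C m = fun z j => whiten C m z j from rfl,
    hind.map_fun_eq_pi_map fun j => (hG.eval j).aemeasurable]
  congr 1
  ext1 j
  rw [(hG.eval j).map_eq_gaussianReal, integral_whiten C hm,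
    ← covariance_self (hG.eval j).aemeasurable, covariance_whiten, hC, Matrix.diagonal_apply_eq]

end whitening

/-! ### The inverse square root of a covariance matrix -/

section inverseSqrt

variable {n : Type*} [Fintype n] [DecidableEq n] {R : Matrix n n ℝ}

theorem sqrt_mul_sqrt_of_posSemidef (hR : R.PosSemidef) : CFC.sqrt R * CFC.sqrt R = R :=
  CFC.sqrt_mul_sqrt_self R (Matrix.nonneg_iff_posSemidef.2 hR)

theorem isUnit_sqrt (hR : R.PosSemidef) (hdet : R.det ≠ 0) : IsUnit (CFC.sqrt R).det := by
  rw [isUnit_iff_ne_zero]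
  intro h
  apply hdet
  rw [← sqrt_mul_sqrt_of_posSemidef hR, Matrix.det_mul, h, zero_mul]

theorem transpose_inv_sqrt (R : Matrix n n ℝ) : (CFC.sqrt R)⁻¹.transpose = (CFC.sqrt R)⁻¹ := by
  have h := (Matrix.nonneg_iff_posSemidef.1 (CFC.sqrt_nonneg R)).isHermitian
  rw [Matrix.IsHermitian, Matrix.conjTranspose_eq_transpose_of_trivial] at h
  rw [Matrix.transpose_nonsing_inv, h]

theorem inv_sqrt_mul_mul_inv_sqrt (hR : R.PosSemidef) (hdet : R.det ≠ 0) :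
    (CFC.sqrt R)⁻¹ * R * (CFC.sqrt R)⁻¹ = 1 := by
  have hu := isUnit_sqrt hR hdet
  conv_lhs => rw [← sqrt_mul_sqrt_of_posSemidef hR]
  set S := CFC.sqrt R with hS
  -- The rewriting of R as a square also acted under the root; this undoes it there.
  have : CFC.sqrt (S * S) = S := by rw [hS, sqrt_mul_sqrt_of_posSemidef hR]
  rw [this, ← mul_assoc, Matrix.nonsing_inv_mul _ hu, one_mul, Matrix.mul_nonsing_inv _ hu]

end inverseSqrt

/-! ### Covariance matrices -/

section covariances

variable {Ω : Type*} [MeasurableSpace Ω] {P : Measure Ω}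
    {p q : ℕ} {X : Ω → Fin p → ℝ} {Y : Ω → Fin q → ℝ}

theorem aestronglyMeasurable_eval {n : ℕ} (i : Fin n) (μ : Measure (Fin n → ℝ)) :
    AEStronglyMeasurable (fun x : Fin n → ℝ => x i) μ :=
  (measurable_pi_apply i).aestronglyMeasurable

theorem posSemidef_crossCov [IsProbabilityMeasure P] (hX : ∀ i, MemLp (fun ω => X ω i) 2 P) :
    (crossCov X X P).PosSemidef := by
  refine Matrix.PosSemidef.of_dotProduct_mulVec_nonneg ?_ fun x => ?_
  · ext i j
    simp [crossCov, covariance_comm]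
  · have h := covariance_fun_sum_fun_sum (μ := P) (X := fun i ω => x i * X ω i)
      (Y := fun i ω => x i * X ω i) (fun i => (hX i).const_mul _) (fun i => (hX i).const_mul _)
    have hm : MemLp (fun ω => ∑ i, x i * X ω i) 2 P :=
      memLp_finsetSum _ fun i _ => (hX i).const_mul _
    rw [covariance_self hm.aestronglyMeasurable.aemeasurable] at h
    have h2 : star x ⬝ᵥ (crossCov X X P).mulVec x = Var[fun ω => ∑ i, x i * X ω i; P] := by
      rw [h]
      simp only [dotProduct, Matrix.mulVec, crossCov, Matrix.of_apply, Finset.mul_sum, star_trivial,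
        covariance_const_mul_left, covariance_const_mul_right]
      exact Finset.sum_congr rfl fun i _ => Finset.sum_congr rfl fun j _ => by ring
    rw [h2]
    exact variance_nonneg _ _

theorem covStack_map (hX : AEMeasurable X P) (hY : AEMeasurable Y P) :
    covStack (P.map fun ω => (X ω, Y ω))
      = Matrix.fromBlocks (crossCov X X P) (crossCov X Y P) (crossCov X Y P).transpose
          (crossCov Y Y P) := by
  have hZ : AEMeasurable (fun ω => (X ω, Y ω)) P := hX.prodMk hY
  have hs : ∀ i, Measurable fun z : (Fin p → ℝ) × (Fin q → ℝ) => stackVec z i := fun i =>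
    (measurable_pi_apply i).comp continuous_stackVec.measurable
  ext i j
  rw [covStack, Matrix.of_apply, covariance_map_fun (hs i).aestronglyMeasurable
    (hs j).aestronglyMeasurable hZ]
  rcases i with i | i <;> rcases j with j | j
  · rfl
  · rfl
  · exact covariance_comm _ _
  · rfl

theorem covStack_prod [IsProbabilityMeasure P] (hX : AEMeasurable X P) (hY : AEMeasurable Y P)
    (hX2 : ∀ i, MemLp (fun ω => X ω i) 2 P) (hY2 : ∀ i, MemLp (fun ω => Y ω i) 2 P) :
    covStack ((P.map X).prod (P.map Y))
      = Matrix.fromBlocks (crossCov X X P) 0 0 (crossCov Y Y P) := by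
  have := Measure.isProbabilityMeasure_map hX
  have := Measure.isProbabilityMeasure_map hY
  have hX3 : ∀ i, MemLp (fun x : Fin p → ℝ => x i) 2 (P.map X) := fun i =>
    (memLp_map_measure_iff (aestronglyMeasurable_eval i _) hX).2 (hX2 i)
  have hY3 : ∀ i, MemLp (fun x : Fin q → ℝ => x i) 2 (P.map Y) := fun i =>
    (memLp_map_measure_iff (aestronglyMeasurable_eval i _) hY).2 (hY2 i)
  ext i j
  rw [covStack, Matrix.of_apply]
  rcases i with i | i <;> rcases j with j | j
  · have h := covariance_map_fun (μ := (P.map X).prod (P.map Y)) (Z := Prod.fst)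
      (X := fun x : Fin p → ℝ => x i) (Y := fun x : Fin p → ℝ => x j)
      (aestronglyMeasurable_eval i _) (aestronglyMeasurable_eval j _) (by fun_prop)
    rw [Measure.map_fst_prod, measure_univ, one_smul, covariance_map_fun (aestronglyMeasurable_eval i _)
      (aestronglyMeasurable_eval j _) hX] at h
    exact h.symm
  · exact covariance_fst_snd_prod (hX3 i) (hY3 j)
  · rw [covariance_comm]
    exact covariance_fst_snd_prod (hX3 j) (hY3 i)
  · have h := covariance_map_fun (μ := (P.map X).prod (P.map Y)) (Z := Prod.snd)
      (X := fun x : Fin q → ℝ => x i) (Y := fun x : Fin q → ℝ => x j)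
      (aestronglyMeasurable_eval i _) (aestronglyMeasurable_eval j _) (by fun_prop)
    rw [Measure.map_snd_prod, measure_univ, one_smul, covariance_map_fun (aestronglyMeasurable_eval i _)
      (aestronglyMeasurable_eval j _) hY] at h
    exact h.symm

/-- The joint law and the product of its marginals have the same mean, so a single affine map
centres both. -/
theorem integral_stackVec_map [IsProbabilityMeasure P] (hX : AEMeasurable X P) (hY : AEMeasurable Y P)
    (i : Fin p ⊕ Fin q) :
    ∫ z, stackVec z i ∂(P.map fun ω => (X ω, Y ω)) = ∫ z, stackVec z i ∂((P.map X).prod (P.map Y)) := by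
  have := Measure.isProbabilityMeasure_map hX
  have := Measure.isProbabilityMeasure_map hY
  have hs : Measurable fun z : (Fin p → ℝ) × (Fin q → ℝ) => stackVec z i :=
    (measurable_pi_apply i).comp continuous_stackVec.measurable
  rw [integral_map (hX.prodMk hY) hs.aestronglyMeasurable]
  rcases i with i | i
  · have h := integral_map (μ := (P.map X).prod (P.map Y)) (φ := Prod.fst)
      (f := fun x : Fin p → ℝ => x i) (by fun_prop) (aestronglyMeasurable_eval i _)
    rw [Measure.map_fst_prod, measure_univ, one_smul, integral_map hX (aestronglyMeasurable_eval i _)] at h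
    exact h
  · have h := integral_map (μ := (P.map X).prod (P.map Y)) (φ := Prod.snd)
      (f := fun x : Fin q → ℝ => x i) (by fun_prop) (aestronglyMeasurable_eval i _)
    rw [Measure.map_snd_prod, measure_univ, one_smul, integral_map hY (aestronglyMeasurable_eval i _)] at h
    exact h

end covariances

/-! ### The law of the information density -/

section density

variable {p q : ℕ} {v : Fin p ⊕ Fin q → ℝ}

/-- If v_j ≤ 0, truncation makes the j-th marginal the Dirac mass at 0, whereas the standard normal
law has no atoms. For v_j = 1 + l_j this excludes the eigenvalue -1, that is, a canonical
correlation 1. -/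
theorem pos_of_pi_gaussianReal_absolutelyContinuous {ι : Type*} [Fintype ι] {v : ι → ℝ}
    (h : Measure.pi (fun j => gaussianReal 0 (v j).toNNReal)
      ≪ Measure.pi fun _ : ι => gaussianReal 0 1) (j : ι) : 0 < v j := by
  by_contra hv
  have h0 : (v j).toNNReal = 0 := Real.toNNReal_of_nonpos (not_lt.1 hv)
  have hs : MeasurableSet ({0} : Set ℝ) := measurableSet_singleton 0
  have h1 := h.map (measurable_pi_apply j)
  rw [(measurePreserving_eval _ j).map_eq, (measurePreserving_eval _ j).map_eq, h0,
    gaussianReal_zero_var] at h1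
  have h2 : gaussianReal 0 1 {(0 : ℝ)} = 0 :=
    gaussianReal_absolutelyContinuous 0 one_ne_zero (measure_singleton 0)
  have h3 := h1 h2
  simp at h3

/-- If an injective affine map sends two Gaussian measures to centred product laws, the second one
standard, then the log-likelihood ratio of the two measures is `logRatio`. -/
theorem log_rnDeriv_eq_logRatio {μ ν : Measure ((Fin p → ℝ) × (Fin q → ℝ))} [IsFiniteMeasure μ]
    [IsFiniteMeasure ν] (hac : μ ≪ ν) {Φ : (Fin p → ℝ) × (Fin q → ℝ) → Fin p ⊕ Fin q → ℝ}
    (hΦ : MeasurableEmbedding Φ) (hv : ∀ j, 0 < v j)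
    (hμ : μ.map Φ = Measure.pi fun j => gaussianReal 0 (v j).toNNReal)
    (hν : ν.map Φ = Measure.pi fun _ => gaussianReal 0 1) :
    ∀ᵐ z ∂μ, Real.log (μ.rnDeriv ν z).toReal = logRatio v (Φ z) := by
  have hmeas : Measurable fun x : Fin p ⊕ Fin q → ℝ =>
      ∏ j, ENNReal.ofReal (gaussRatio (v j) (x j)) :=
    Finset.measurable_prod _ fun j _ =>
      ((measurable_gaussRatio (v j)).comp (measurable_pi_apply j)).ennreal_ofReal
  have h1 := hΦ.rnDeriv_map μ ν
  have h2 : ∀ᵐ x ∂(ν.map Φ), (μ.map Φ).rnDeriv (ν.map Φ) x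
      = ∏ j, ENNReal.ofReal (gaussRatio (v j) (x j)) := by
    rw [hμ, hν, pi_gaussianReal_eq_withDensity hv]
    exact Measure.rnDeriv_withDensity _ hmeas
  have h3 := ae_of_ae_map hΦ.measurable.aemeasurable h2
  -- Densities are determined only almost everywhere for ν; absolute continuity carries both
  -- identities over to μ.
  filter_upwards [hac.ae_le h1, hac.ae_le h3] with z hz1 hz2
  rw [← hz1, hz2, ENNReal.toReal_prod, logRatio, ← Real.log_prod]
  · simp_rw [ENNReal.toReal_ofReal (gaussRatio_pos (hv _) _).le]
  · exact fun j _ => (gaussRatio_pos (hv j) _).ne'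

end density

/-! ### Simultaneous diagonalisation, and the characteristic function of the centred information
density. -/

section infoDensity

variable {Ω : Type*} [MeasurableSpace Ω] {P : Measure Ω}
    {p q : ℕ} {X : Ω → Fin p → ℝ} {Y : Ω → Fin q → ℝ}

/-- The matrix `R_X^(-1/2) R_XY R_Y^(-1/2)`. -/
noncomputable def coherence (X : Ω → Fin p → ℝ) (Y : Ω → Fin q → ℝ) (P : Measure Ω) :
    Matrix (Fin p) (Fin q) ℝ :=
  (CFC.sqrt (crossCov X X P))⁻¹ * crossCov X Y P * (CFC.sqrt (crossCov Y Y P))⁻¹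

/-- Up to an affine change of coordinates, the joint law and the product of the marginal laws are
centred Gaussian product laws; the variances are given by the eigenvalues of the Hermitian dilation
of the coherence matrix. -/
theorem exists_measurableEmbedding_map_eq_pi [IsProbabilityMeasure P]
    (hXY : HasGaussianLaw (fun ω => (X ω, Y ω)) P)
    (hX : (crossCov X X P).det ≠ 0) (hY : (crossCov Y Y P).det ≠ 0) :
    ∃ Φ : (Fin p → ℝ) × (Fin q → ℝ) → Fin p ⊕ Fin q → ℝ, MeasurableEmbedding Φ ∧
      (P.map fun ω => (X ω, Y ω)).map Φ = Measure.pi (fun j => gaussianReal 0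
        (1 + (isHermitian_hermDilation (coherence X Y P)).eigenvalues j).toNNReal) ∧
      ((P.map X).prod (P.map Y)).map Φ = Measure.pi fun _ => gaussianReal 0 1 := by
  have hXm : AEMeasurable X P := hXY.fst.aemeasurable
  have hYm : AEMeasurable Y P := hXY.snd.aemeasurable
  have hX2 : ∀ i, MemLp (fun ω => X ω i) 2 P := fun i => (hXY.fst.eval i).memLp_two
  have hY2 : ∀ i, MemLp (fun ω => Y ω i) 2 P := fun i => (hXY.snd.eval i).memLp_two
  have := hXY.isGaussian_map
  have := hXY.fst.isGaussian_map
  have := hXY.snd.isGaussian_map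
  set μ := P.map fun ω => (X ω, Y ω) with hμ
  set ν := (P.map X).prod (P.map Y) with hν
  set M := coherence X Y P with hM
  set hH := isHermitian_hermDilation M
  set U : Matrix (Fin p ⊕ Fin q) (Fin p ⊕ Fin q) ℝ := hH.eigenvectorUnitary.1
  set A := (CFC.sqrt (crossCov X X P))⁻¹ with hA
  set B := (CFC.sqrt (crossCov Y Y P))⁻¹ with hB
  have hAt : A.transpose = A := transpose_inv_sqrt _
  have hBt : B.transpose = B := transpose_inv_sqrt _
  have hA1 : A * crossCov X X P * A = 1 := inv_sqrt_mul_mul_inv_sqrt (posSemidef_crossCov hX2) hX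
  have hB1 : B * crossCov Y Y P * B = 1 := inv_sqrt_mul_mul_inv_sqrt (posSemidef_crossCov hY2) hY
  have hU1 : star U * U = 1 := Unitary.coe_star_mul_self _
  -- The block factor makes the product covariance 1 and the joint covariance 1 + `hermDilation M`.
  -- The rotation preserves the former and diagonalises the latter.
  set C := star U * Matrix.fromBlocks A 0 0 B with hC
  have hCt : C.transpose = Matrix.fromBlocks A 0 0 B * U := by
    rw [hC, Matrix.transpose_mul, Matrix.fromBlocks_transpose, hAt, hBt, Matrix.transpose_zero,
      Matrix.transpose_zero, Matrix.star_eq_conjTranspose,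
      Matrix.conjTranspose_eq_transpose_of_trivial, Matrix.transpose_transpose]
  have hBν : Matrix.fromBlocks A 0 0 B * covStack ν * Matrix.fromBlocks A 0 0 B = 1 := by
    rw [hν, covStack_prod hXm hYm hX2 hY2, Matrix.fromBlocks_multiply, Matrix.fromBlocks_multiply]
    simp only [Matrix.mul_zero, Matrix.zero_mul, add_zero, zero_add, hA1, hB1,
      Matrix.fromBlocks_one]
  have hBμ : Matrix.fromBlocks A 0 0 B * covStack μ * Matrix.fromBlocks A 0 0 B
      = 1 + hermDilation M := by
    rw [hμ, covStack_map hXm hYm, Matrix.fromBlocks_multiply, Matrix.fromBlocks_multiply,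
      hermDilation, ← Matrix.fromBlocks_one, Matrix.fromBlocks_add]
    have hMt : M.transpose = B * (crossCov X Y P).transpose * A := by
      rw [hM, coherence, Matrix.transpose_mul, Matrix.transpose_mul, ← hA, ← hB, hAt, hBt,
        Matrix.mul_assoc]
    simp only [Matrix.mul_zero, Matrix.zero_mul, add_zero, zero_add, hA1, hB1, hMt]
    rfl
  have hCν : C * covStack ν * C.transpose = 1 := by
    rw [hCt, hC]
    calc _ = star U * (Matrix.fromBlocks A 0 0 B * covStack ν * Matrix.fromBlocks A 0 0 B) * U := by
          simp only [mul_assoc]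
      _ = 1 := by rw [hBν, mul_one, hU1]
  have hCμ : C * covStack μ * C.transpose = Matrix.diagonal fun j => 1 + hH.eigenvalues j := by
    rw [hCt, hC]
    calc _ = star U * (Matrix.fromBlocks A 0 0 B * covStack μ * Matrix.fromBlocks A 0 0 B) * U := by
          simp only [mul_assoc]
      _ = 1 + star U * hermDilation M * U := by rw [hBμ, mul_add, add_mul, mul_one, hU1]
      _ = 1 + Matrix.diagonal hH.eigenvalues := by
          have h := hH.conjStarAlgAut_star_eigenvectorUnitary
          rw [Unitary.conjStarAlgAut_star_apply] at h
          congr 1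
      _ = _ := by
          rw [← Matrix.diagonal_one, Matrix.diagonal_add]
  have hCu : IsUnit C := by
    rw [Matrix.isUnit_iff_isUnit_det]
    -- The identity for the product covariance already exhibits a right inverse of C.
    refine isUnit_of_mul_isUnit_left (y := (covStack ν * C.transpose).det) ?_
    rw [← Matrix.det_mul, ← mul_assoc, hCν, Matrix.det_one]
    exact isUnit_one
  refine ⟨whiten C fun i => ∫ z, stackVec z i ∂ν, measurableEmbedding_whiten hCu _,
    map_whiten (fun i => ?_) hCμ, ?_⟩
  · exact (integral_stackVec_map hXm hYm i).symm
  · have h := map_whiten (μ := ν) (m := fun i => ∫ z, stackVec z i ∂ν) (v := fun _ => 1)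
      (fun i => rfl) (by rw [hCν, Matrix.diagonal_one])
    simpa using h

theorem rank_coherence [IsProbabilityMeasure P]
    (hXY : HasGaussianLaw (fun ω => (X ω, Y ω)) P)
    (hX : (crossCov X X P).det ≠ 0) (hY : (crossCov Y Y P).det ≠ 0) :
    (coherence X Y P).rank = (crossCov X Y P).rank := by
  have hX' := isUnit_sqrt (posSemidef_crossCov fun i => (hXY.fst.eval i).memLp_two) hX
  have hY' := isUnit_sqrt (posSemidef_crossCov fun i => (hXY.snd.eval i).memLp_two) hY
  rw [coherence, Matrix.rank_mul_eq_left_of_isUnit_det _ _ (Matrix.isUnit_nonsing_inv_det _ hY'),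
    Matrix.rank_mul_eq_right_of_isUnit_det _ _ (Matrix.isUnit_nonsing_inv_det _ hX')]

theorem canonicalCorr_antitone (X : Ω → Fin p → ℝ) (Y : Ω → Fin q → ℝ) (P : Measure Ω) :
    Antitone (canonicalCorr X Y P) :=
  LinearMap.singularValues_antitone _

theorem canonicalCorr_pos {i : ℕ} (hi : i < (coherence X Y P).rank) :
    0 < canonicalCorr X Y P i := by
  refine (LinearMap.singularValues_pos_iff_lt_finrank_range _).2 (hi.trans_eq ?_)
  rw [Matrix.rank_eq_finrank_range_toLin _ (PiLp.basisFun 2 ℝ (Fin p))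
    (PiLp.basisFun 2 ℝ (Fin q))]
  rfl

/-- The information density is integrable, and the characteristic function of the centred
information density is `∏ (1 + ρᵢ² t²)^(-1/2)`. -/
theorem integrable_infoDensity_and_charFun [IsProbabilityMeasure P]
    (hXY : HasGaussianLaw (fun ω => (X ω, Y ω)) P)
    (hX : (crossCov X X P).det ≠ 0) (hY : (crossCov Y Y P).det ≠ 0)
    (hac : (P.map fun ω => (X ω, Y ω)) ≪ (P.map X).prod (P.map Y)) :
    Integrable (infoDensity X Y P) P ∧
    ∀ t, charFun (P.map fun ω => infoDensity X Y P ω - mutualInfo X Y P) t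
      = (∏ i ∈ Finset.range (coherence X Y P).rank,
          (1 + canonicalCorr X Y P i ^ 2 * t ^ 2) ^ (-(1 / 2) : ℝ) : ℝ) := by
  have hZ : AEMeasurable (fun ω => (X ω, Y ω)) P := hXY.aemeasurable
  have := hXY.isGaussian_map
  have := hXY.fst.isGaussian_map
  have := hXY.snd.isGaussian_map
  obtain ⟨Φ, hΦ, hμ, hν⟩ := exists_measurableEmbedding_map_eq_pi hXY hX hY
  set l := (isHermitian_hermDilation (coherence X Y P)).eigenvalues with hl
  have hv : ∀ j, 0 < 1 + l j := by
    refine pos_of_pi_gaussianReal_absolutelyContinuous ?_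
    rw [← hμ, ← hν]
    exact hac.map hΦ.measurable
  have hW : AEMeasurable (fun ω => Φ (X ω, Y ω)) P := hΦ.measurable.comp_aemeasurable hZ
  have hlaw : P.map (fun ω => Φ (X ω, Y ω))
      = Measure.pi fun j => gaussianReal 0 (1 + l j).toNNReal := by
    rw [← hμ, AEMeasurable.map_map_of_aemeasurable hΦ.measurable.aemeasurable hZ]
    rfl
  have hinfo : infoDensity X Y P =ᵐ[P] fun ω => logRatio (fun j => 1 + l j) (Φ (X ω, Y ω)) :=
    ae_of_ae_map hZ (log_rnDeriv_eq_logRatio hac hΦ hv hμ hν)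
  have hG := measurable_logRatio fun j => 1 + l j
  have hmean : mutualInfo X Y P = ∫ x, logRatio (fun j => 1 + l j) x
      ∂(Measure.pi fun j => gaussianReal 0 (1 + l j).toNNReal) := by
    rw [mutualInfo, integral_congr_ae hinfo, ← hlaw, integral_map hW hG.aestronglyMeasurable]
  refine ⟨?_, fun t => ?_⟩
  · refine Integrable.congr ?_ hinfo.symm
    have h := integrable_logRatio hv
    rw [← hlaw] at h
    exact h.comp_aemeasurable hW
  · have hae : (fun ω => infoDensity X Y P ω - mutualInfo X Y P) =ᵐ[P]
        fun ω => logRatio (fun j => 1 + l j) (Φ (X ω, Y ω)) - mutualInfo X Y P := by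
      filter_upwards [hinfo] with ω hω
      rw [hω]
    have hmeas : AEMeasurable (fun ω => logRatio (fun j => 1 + l j) (Φ (X ω, Y ω))
        - mutualInfo X Y P) P := (hG.comp_aemeasurable hW).sub_const _
    rw [Measure.map_congr hae, charFun_apply_real, integral_map hmeas (by fun_prop)]
    have hsum : ∑ j, (1 + l j - 1) = 0 := by
      simp only [add_sub_cancel_left]
      exact sum_eigenvalues_hermDilation _
    have h := integral_cexp_logRatio hv hsum t
    rw [← hmean, ← hlaw, integral_map hW (by fun_prop)] at h
    rw [h]
    simp only [add_sub_cancel_left]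
    exact prod_cpow_eigenvalues_hermDilation _ t

end infoDensity

/-! ### The distribution function of the information density. -/

theorem theorem2 {Ω : Type*} [MeasurableSpace Ω] (P : Measure Ω) [IsProbabilityMeasure P]
    {p q : ℕ} (X : Ω → Fin p → ℝ) (Y : Ω → Fin q → ℝ)
    (hXY : HasGaussianLaw (fun ω => (X ω, Y ω)) P)
    (hX : (crossCov X X P).det ≠ 0) (hY : (crossCov Y Y P).det ≠ 0)
    (hac : (P.map fun ω => (X ω, Y ω)) ≪ (P.map X).prod (P.map Y))
    (r : ℕ) (hr : (crossCov X Y P).rank = r) (hr1 : 1 ≤ r) :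
    Integrable (infoDensity X Y P) P ∧
    (∀ z : ℝ, 0 ≤ z → Summable (vTerm r (canonicalCorr X Y P) z)) ∧
    ∀ x : ℝ, cdf (P.map (infoDensity X Y P)) x =
      if x ≤ mutualInfo X Y P then
        1 / 2 - vFun r (canonicalCorr X Y P) (mutualInfo X Y P - x)
      else
        1 / 2 + vFun r (canonicalCorr X Y P) (x - mutualInfo X Y P) := by
  obtain ⟨hint, hchar⟩ := integrable_infoDensity_and_charFun hXY hX hY hac
  rw [rank_coherence hXY hX hY, hr] at hchar
  have hi : AEMeasurable (infoDensity X Y P) P := hint.aemeasurable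
  have hpos : 0 < canonicalCorr X Y P (r - 1) :=
    canonicalCorr_pos (by rw [rank_coherence hXY hX hY, hr]; omega)
  have := Measure.isProbabilityMeasure_map hi
  have := Measure.isProbabilityMeasure_map (hi.sub_const (mutualInfo X Y P))
  obtain ⟨hs, hcdf⟩ := cdf_eq_of_charFun hr1 (canonicalCorr_antitone X Y P) hpos hchar
  refine ⟨hint, hs, fun x => ?_⟩
  -- The event that the information density is at most x is the event that its centred version is at
  -- most x minus the mean.
  have h := hcdf (x - mutualInfo X Y P)
  rw [map_measureReal_apply_of_aemeasurable (hi.sub_const _) measurableSet_Iic] at h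
  rw [cdf_eq_real, map_measureReal_apply_of_aemeasurable hi measurableSet_Iic]
  convert! h using 2
  · ext ω; simp
  · simp
  · rw [neg_sub]
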